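/- There is an absolute constant $C>0$ with the following property. Let $X\in\mathbb{R}^{n\times d}$ ($d\ge 1$) have a thin singular value decomposition $X=U\Sigma V^T$, where $U\in\mathbb{R}^{n\times d}$ and $V\in\mathbb{R}^{d\times d}$ have orthonormal columns and $\Sigma=\mathrm{diag}(\sigma_1,\dots,\sigma_d)$ contains the singular values $\sigma_{\max}(X)=\sigma_1\ge\dots\ge\sigma_d=\sigma_{\min}(X)\ge 0$ of $X$ (so $n\ge d$). Let $y\in\mathbb{R}^n$, let $\beta_{LSR}$ be a minimizer of $\|y-X\beta\|_2^2$ over $\beta\in\mathbb{R}^d$, and let $\varepsilon>0$, where $\varepsilon\le 1$ if $d=1$. Let $l_i=\|u^{(i)}\|_2^2$ be the leverage scores, $u^{(i)}$ being the $i$-th row of $U$. Let $c$ be a natural number with $$c\ \ge\ C\,(d\ln d+d/\varepsilon),$$ put $p_i=\min\{1,\,c\,l_i/d\}$, select each index $i\in\{1,\dots,n\}$ independently with probability $p_i$, and let the sampling matrix $S$ consist of the rows of $\mathrm{diag}(p_1^{-1/2},\dots,p_n^{-1/2})$ with selected indices (leverage-score sampling without replacement). Then with probability at least $0.8$ every minimizer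 $\tilde\beta_S$ of $\|Sy-SX\beta\|_2^2$ over $\beta\in\mathbb{R}^d$ satisfies $$\|y-X\tilde\beta_S\|_2^2\ \le\ (1+\varepsilon)\,\|y-X\beta_{LSR}\|_2^2,$$ and, if moreover $\sigma_{\min}(X)>0$, $$\|\beta_{LSR}-\tilde\beta_S\|_2^2\ \le\ \frac{\varepsilon}{\sigma_{\min}^2(X)}\,\|y-X\beta_{LSR}\|_2^2\ \le\ \varepsilon\,\kappa^2(X)\,(\gamma^{-2}-1)\,\|\beta_{LSR}\|_2^2,$$ where $\kappa(X)=\sigma_{\max}(X)/\sigma_{\min}(X)$ and the last inequality holds for every $\gamma>0$ with $\gamma\,\|y\|_2\le\|UU^Ty\|_2$. -/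

import Mathlib

open MeasureTheory

noncomputable section

namespace LeverageLSR

/-- The singular values `σ₁(X) ≥ σ₂(X) ≥ ⋯ ≥ σ_d(X)` of an `n × d` real matrix, indexed from `0`
(so `singularValue X 0` is the largest one and `singularValue X (d - 1)` the smallest one). -/
def singularValue {n d : ℕ} (X : Matrix (Fin n) (Fin d) ℝ) (i : ℕ) : ℝ :=
  X.toEuclideanLin.singularValues i

/-- The smallest singular value `σ_d(X)` of an `n × d` matrix. -/
def sigmaMin {n d : ℕ} (X : Matrix (Fin n) (Fin d) ℝ) : ℝ := singularValue X (d - 1)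

/-- The largest singular value `σ₁(X)`. -/
def sigmaMax {n d : ℕ} (X : Matrix (Fin n) (Fin d) ℝ) : ℝ := singularValue X 0

/-- The condition number `κ(X) = σ_max(X) / σ_min(X)`. -/
def condNumber {n d : ℕ} (X : Matrix (Fin n) (Fin d) ℝ) : ℝ := sigmaMax X / sigmaMin X

/-- `X = U Σ Vᵀ` is a thin singular value decomposition: `U` is `n × d` and `V` is `d × d`, both
with orthonormal columns, and `Σ` is the diagonal matrix of the singular values of `X` in
non-increasing order. -/
structure IsThinSVD {n d : ℕ} (X : Matrix (Fin n) (Fin d) ℝ)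
    (U : Matrix (Fin n) (Fin d) ℝ) (V : Matrix (Fin d) (Fin d) ℝ) : Prop where
  left_orthonormal : U.transpose * U = 1
  right_orthonormal : V.transpose * V = 1
  eq_mul : X = U * Matrix.diagonal (fun i : Fin d => singularValue X i) * V.transpose

/-- Every `n × d` real matrix with `d ≤ n` has a thin singular value decomposition. -/
theorem exists_isThinSVD {n d : ℕ} (h : d ≤ n) (X : Matrix (Fin n) (Fin d) ℝ) :
    ∃ U V, IsThinSVD X U V := by
  classical
  set T := X.toEuclideanLin with hT
  have hd : Module.finrank ℝ (EuclideanSpace ℝ (Fin d)) = d := by simp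
  set b := T.isSymmetric_adjoint_comp_self.eigenvectorBasis hd with hb
  have key : ∀ i j, inner ℝ (T (b i)) (T (b j)) = if i = j then singularValue X j ^ 2 else 0 := by
    intro i j
    have h1 := T.isSymmetric_adjoint_comp_self.apply_eigenvectorBasis hd j
    have h2 : inner ℝ (T (b i)) (T (b j)) = inner ℝ (b i) ((LinearMap.adjoint T ∘ₗ T) (b j)) := by
      simp [LinearMap.adjoint_inner_right]
    rw [h2, h1, singularValue, T.sq_singularValues_fin hd j, inner_smul_right,
      orthonormal_iff_ite.mp b.orthonormal i j]
    simp
  let f : Fin n → EuclideanSpace ℝ (Fin n) := fun k => if hk : k.1 < d then T (b ⟨k, hk⟩) else 0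
  have hf : Pairwise fun i j => inner ℝ (f i) (f j) = 0 := by
    intro i j hij
    simp only [f]
    split_ifs with h1 h2 <;> simp [key]
    intro h3; exact absurd (Fin.ext h3) hij
  let u := InnerProductSpace.gramSchmidtOrthonormalBasis (𝕜 := ℝ) (by simp) f
  have hu : ∀ j : Fin d, T (b j) = singularValue X j • u (Fin.castLE h j) := by
    intro j
    have hfj : f (Fin.castLE h j) = T (b j) := by simp [f]
    have hn : ‖T (b j)‖ = singularValue X j := by
      have := key j j
      rw [real_inner_self_eq_norm_sq, if_pos rfl] at this
      exact (pow_left_inj₀ (norm_nonneg _) (T.singularValues_nonneg _) two_ne_zero).mp this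
    by_cases h0 : f (Fin.castLE h j) = 0
    · rw [hfj] at h0; rw [h0, norm_zero] at hn; rw [h0, ← hn, zero_smul]
    · rw [InnerProductSpace.gramSchmidtOrthonormalBasis_apply_of_orthogonal (by simp) hf h0, hfj, hn, smul_smul]
      rw [hfj] at h0
      have : singularValue X j ≠ 0 := by rw [← hn]; simpa using h0
      simp [this]
  have hV : (Matrix.of fun i j => b j i).transpose * (Matrix.of fun i j => b j i) = 1 := by
    ext i j
    have := orthonormal_iff_ite.mp b.orthonormal i j
    simp [Matrix.mul_apply, PiLp.inner_apply, Matrix.one_apply] at this ⊢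
    rw [← this]; exact Finset.sum_congr rfl fun _ _ => mul_comm _ _
  refine ⟨Matrix.of fun i j => u (Fin.castLE h j) i, Matrix.of fun i j => b j i, ?_, hV, ?_⟩
  · ext i j
    have := orthonormal_iff_ite.mp u.orthonormal (Fin.castLE h i) (Fin.castLE h j)
    simp [Matrix.mul_apply, PiLp.inner_apply, Matrix.one_apply] at this ⊢
    rw [← this]; exact Finset.sum_congr rfl fun _ _ => mul_comm _ _
  · have : X * (Matrix.of fun i j => b j i) = (Matrix.of fun i j => u (Fin.castLE h j) i) *
        Matrix.diagonal (fun i : Fin d => singularValue X i) := by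
      ext i j
      have := congrArg (fun v : EuclideanSpace ℝ (Fin n) => v i) (hu j)
      simp [T, Matrix.toLpLin_apply, Matrix.mulVec, dotProduct] at this
      rw [Matrix.mul_diagonal]
      simp [Matrix.mul_apply, this, mul_comm]
    rw [← this, Matrix.mul_assoc, mul_eq_one_comm.mp hV, Matrix.mul_one]

/-- The `i`-th row leverage score `‖u⁽ⁱ⁾‖₂²`, where `u⁽ⁱ⁾` is the `i`-th row of the matrix `U` of
left singular vectors. -/
def leverageScore {n d : ℕ} (U : Matrix (Fin n) (Fin d) ℝ) (i : Fin n) : ℝ :=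
  ‖(WithLp.toLp 2 (U i) : EuclideanSpace ℝ (Fin d))‖ ^ 2

/-- The sampling probability `p_i = min {1, c l_i / d}` as an element of the unit interval. -/
def samplingProb {n d : ℕ} (U : Matrix (Fin n) (Fin d) ℝ) (c : ℕ) (i : Fin n) : unitInterval :=
  ⟨min 1 ((c : ℝ) * leverageScore U i / d),
    le_min zero_le_one (by unfold leverageScore; positivity), min_le_left _ _⟩

/-- The law of the random selection: every index `i` is selected (`ω i = true`) with probability
`p_i`, independently of all the other indices. -/
def selectionLaw {n d : ℕ} (U : Matrix (Fin n) (Fin d) ℝ) (c : ℕ) : Measure (Fin n → Bool) :=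
  Measure.pi fun i => ProbabilityTheory.bernoulliMeasure true false (samplingProb U c i)

/-- The sampling matrix `S`: the rows, indexed by the selected indices, of the diagonal matrix
`D = diag (p₁^{-1/2}, …, p_n^{-1/2})`. (An index with `p_i = 0` is almost surely not selected.) -/
def samplingMatrix {n d : ℕ} (U : Matrix (Fin n) (Fin d) ℝ) (c : ℕ) (ω : Fin n → Bool) :
    Matrix {i : Fin n // ω i = true} (Fin n) ℝ :=
  (Matrix.diagonal fun i => (Real.sqrt (samplingProb U c i))⁻¹).submatrix Subtype.val id

/-- `β` is a solution of the least squares problem `min_β ‖b - A β‖₂²`. -/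
def IsLeastSquaresSolution {m : Type*} [Fintype m] {d : ℕ} (A : Matrix m (Fin d) ℝ)
    (b : EuclideanSpace ℝ m) (β : EuclideanSpace ℝ (Fin d)) : Prop :=
  IsMinOn (fun β' => ‖b - A.toEuclideanLin β'‖ ^ 2) Set.univ β

end LeverageLSR

end

/-! Let r = y − Xβ be the full residual, let wᵢ be 1/pᵢ on selected indices and 0 elsewhere, and let
z = ΣVᵀ(β̃ − β), so that X(β̃ − β) = Uz. As r is orthogonal to the range of X, the excess loss is
exactly |z|², and |β̃ − β|² ≤ |z|²/σ_min² when σ_min > 0. Everything reduces to |z|² ≤ ε|r|².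

The sampled normal equations give ∑ wᵢ(u⁽ⁱ⁾·z)² = z·g with g = ∑ wᵢ rᵢ u⁽ⁱ⁾, columns of U of zero
singular value being dropped. Two events, each failing with probability at most 1/10, suffice: the
left side is at least |z|²/4 (`measureReal_not_embedding_le`), and |g|² ≤ 10(d/c)|r|²
(`measureReal_sum_sq_le`, a variance bound, since g has mean zero). Together they give |z|² ≤
160(d/c)|r|².

The embedding uses the potential Tr B^{-q}, with B = 1/4 + ∑ wᵢ u⁽ⁱ⁾u⁽ⁱ⁾ᵀ and q of order log d. A
small update x·vvᵀ lowers it by between x/2 and x times q·vᵀB^{-(q+1)}v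
(`trace_inv_pow_add_smul_vecMulVec`). When pᵢ < 1, the random weight therefore lowers it on average
at least as much as the constant weight 1/2. Replacing weights one at a time leaves a matrix bounded
below by 3/4, and Markov's inequality bounds all eigenvalues of the random B from below by 1/2. -/

noncomputable section

namespace LeverageLSR

open Matrix

/-! ### Traces of inverse powers and eigenvalue bounds -/

section Spectral

variable {d : ℕ}

/-- Quadratic forms of an orthogonally diagonalized matrix. -/
lemma dotProduct_conj_diagonal_mulVec (W : Matrix (Fin d) (Fin d) ℝ) (f : Fin d → ℝ)
    (v : Fin d → ℝ) :
    v ⬝ᵥ ((W * diagonal f * Wᵀ) *ᵥ v) = ∑ i, f i * (Wᵀ *ᵥ v) i ^ 2 := by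
  rw [← mulVec_mulVec, ← mulVec_mulVec, dotProduct_mulVec, ← mulVec_transpose, dotProduct]
  refine Finset.sum_congr rfl fun i _ => ?_
  rw [mulVec_diagonal]
  ring

lemma sum_sq_transpose_mulVec {W : Matrix (Fin d) (Fin d) ℝ} (hW : W * Wᵀ = 1) (v : Fin d → ℝ) :
    ∑ i, (Wᵀ *ᵥ v) i ^ 2 = v ⬝ᵥ v := by
  have := dotProduct_conj_diagonal_mulVec W (fun _ => 1) v
  rw [diagonal_one, Matrix.mul_one, hW, one_mulVec] at this
  simpa using this.symm

lemma exists_spectral_decomposition {B : Matrix (Fin d) (Fin d) ℝ} (hB : B.IsHermitian) :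
    ∃ (W : Matrix (Fin d) (Fin d) ℝ) (l : Fin d → ℝ), W * Wᵀ = 1 ∧ Wᵀ * W = 1 ∧
      B = W * diagonal l * Wᵀ := by
  refine ⟨hB.eigenvectorUnitary, hB.eigenvalues, ?_, ?_, ?_⟩
  · have := Unitary.coe_mul_star_self hB.eigenvectorUnitary
    simpa [star_eq_conjTranspose] using this
  · have := Unitary.coe_star_mul_self hB.eigenvectorUnitary
    simpa [star_eq_conjTranspose] using this
  · have := hB.spectral_theorem
    rw [Unitary.conjStarAlgAut_apply] at this
    simpa [star_eq_conjTranspose, Function.comp_def] using this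

lemma inv_pow_conj_diagonal {W : Matrix (Fin d) (Fin d) ℝ} {l : Fin d → ℝ} (h1 : W * Wᵀ = 1)
    (h2 : Wᵀ * W = 1) (hl : ∀ i, 0 < l i) (k : ℕ) :
    (W * diagonal l * Wᵀ)⁻¹ ^ k = W * diagonal (fun i => (l i)⁻¹ ^ k) * Wᵀ := by
  have hmul : ∀ f g : Fin d → ℝ, (W * diagonal f * Wᵀ) * (W * diagonal g * Wᵀ) =
      W * diagonal (fun i => f i * g i) * Wᵀ := by
    intro f g
    calc (W * diagonal f * Wᵀ) * (W * diagonal g * Wᵀ)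
        = W * diagonal f * (Wᵀ * W) * diagonal g * Wᵀ := by simp only [Matrix.mul_assoc]
      _ = _ := by rw [h2, Matrix.mul_one, Matrix.mul_assoc W, diagonal_mul_diagonal]
  have hinv : (W * diagonal l * Wᵀ)⁻¹ = W * diagonal (fun i => (l i)⁻¹) * Wᵀ := by
    refine inv_eq_right_inv ?_
    rw [hmul]
    have : (fun i => l i * (l i)⁻¹) = fun _ => (1 : ℝ) :=
      funext fun i => mul_inv_cancel₀ (hl i).ne'
    rw [this, diagonal_one, Matrix.mul_one, h1]
  rw [hinv]
  induction k with
  | zero => simp [h1]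
  | succ k ih => rw [pow_succ, ih, hmul]; simp only [pow_succ]

lemma trace_conj_diagonal {W : Matrix (Fin d) (Fin d) ℝ} (h2 : Wᵀ * W = 1) (f : Fin d → ℝ) :
    (W * diagonal f * Wᵀ).trace = ∑ i, f i := by
  rw [Matrix.trace_mul_comm, ← Matrix.mul_assoc, h2, Matrix.one_mul, trace_diagonal]

/-- A matrix bounded below by `u` has an eigendecomposition with eigenvalues at least `u`. -/
lemma exists_spectral_decomposition_of_le {B : Matrix (Fin d) (Fin d) ℝ} (hB : B.IsHermitian)
    {u : ℝ} (hu : ∀ z, u * (z ⬝ᵥ z) ≤ z ⬝ᵥ (B *ᵥ z)) :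
    ∃ (W : Matrix (Fin d) (Fin d) ℝ) (l : Fin d → ℝ), W * Wᵀ = 1 ∧ Wᵀ * W = 1 ∧
      B = W * diagonal l * Wᵀ ∧ ∀ i, u ≤ l i := by
  obtain ⟨W, l, h1, h2, h3⟩ := exists_spectral_decomposition hB
  refine ⟨W, l, h1, h2, h3, fun i => ?_⟩
  have h := hu (W *ᵥ Pi.single i 1)
  rw [h3, dotProduct_conj_diagonal_mulVec, ← sum_sq_transpose_mulVec h1, mulVec_mulVec, h2,
    one_mulVec] at h
  simpa [Pi.single_apply] using h

lemma trace_inv_pow_le {B : Matrix (Fin d) (Fin d) ℝ} (hB : B.IsHermitian) {u : ℝ} (hu0 : 0 < u)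
    (hu : ∀ z, u * (z ⬝ᵥ z) ≤ z ⬝ᵥ (B *ᵥ z)) (q : ℕ) : (B⁻¹ ^ q).trace ≤ d * u⁻¹ ^ q := by
  obtain ⟨W, l, h1, h2, rfl, hl⟩ := exists_spectral_decomposition_of_le hB hu
  have hl0 : ∀ i, 0 < l i := fun i => hu0.trans_le (hl i)
  rw [inv_pow_conj_diagonal h1 h2 hl0, trace_conj_diagonal h2]
  calc ∑ i, (l i)⁻¹ ^ q ≤ ∑ _i : Fin d, u⁻¹ ^ q := by
        gcongr with i
        · exact inv_nonneg.2 (hl0 i).le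
        · exact hl i
    _ = _ := by simp

lemma trace_inv_pow_nonneg {B : Matrix (Fin d) (Fin d) ℝ} (hB : B.IsHermitian) {u : ℝ}
    (hu0 : 0 < u) (hu : ∀ z, u * (z ⬝ᵥ z) ≤ z ⬝ᵥ (B *ᵥ z)) (q : ℕ) : 0 ≤ (B⁻¹ ^ q).trace := by
  obtain ⟨W, l, h1, h2, rfl, hl⟩ := exists_spectral_decomposition_of_le hB hu
  have hl0 : ∀ i, 0 < l i := fun i => hu0.trans_le (hl i)
  rw [inv_pow_conj_diagonal h1 h2 hl0, trace_conj_diagonal h2]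
  exact Finset.sum_nonneg fun i _ => pow_nonneg (inv_nonneg.2 (hl0 i).le) _

/-- If the trace of `B⁻¹ ^ q` is at most `t⁻¹ ^ q`, all the eigenvalues of `B` are at least `t`. -/
lemma le_of_trace_inv_pow_le {B : Matrix (Fin d) (Fin d) ℝ} (hB : B.IsHermitian) {u t : ℝ}
    (hu0 : 0 < u) (hu : ∀ z, u * (z ⬝ᵥ z) ≤ z ⬝ᵥ (B *ᵥ z)) (ht : 0 < t) {q : ℕ} (hq : q ≠ 0)
    (h : (B⁻¹ ^ q).trace ≤ t⁻¹ ^ q) (z : Fin d → ℝ) : t * (z ⬝ᵥ z) ≤ z ⬝ᵥ (B *ᵥ z) := by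
  obtain ⟨W, l, h1, h2, rfl, hl⟩ := exists_spectral_decomposition_of_le hB hu
  have hl0 : ∀ i, 0 < l i := fun i => hu0.trans_le (hl i)
  rw [inv_pow_conj_diagonal h1 h2 hl0, trace_conj_diagonal h2] at h
  rw [dotProduct_conj_diagonal_mulVec, ← sum_sq_transpose_mulVec h1, Finset.mul_sum]
  gcongr with i
  have h4 : (l i)⁻¹ ^ q ≤ t⁻¹ ^ q := le_trans (Finset.single_le_sum
    (f := fun i => (l i)⁻¹ ^ q) (fun i _ => pow_nonneg (inv_nonneg.2 (hl0 i).le) _)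
    (Finset.mem_univ i)) h
  have h5 := (pow_le_pow_iff_left₀ (inv_nonneg.2 (hl0 i).le) (inv_nonneg.2 ht.le) hq).1 h4
  exact (inv_le_inv₀ (hl0 i) ht).1 h5

end Spectral

/-- Chebyshev's association inequality for powers, with weights. -/
lemma sum_pow_mul_sum_pow_le {ι : Type*} [Fintype ι] {r w : ι → ℝ} (hr : ∀ i, 0 ≤ r i)
    (hw : ∀ i, 0 ≤ w i) (a b : ℕ) :
    (∑ i, r i ^ a * w i) * (∑ i, r i ^ b * w i) ≤ (∑ i, w i) * ∑ i, r i ^ (a + b) * w i := by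
  -- Both powers are monotone on nonnegative reals, so the two differences always have the same
  -- sign.
  have h : 0 ≤ ∑ i, ∑ j, w i * w j * ((r i ^ a - r j ^ a) * (r i ^ b - r j ^ b)) := by
    refine Finset.sum_nonneg fun i _ => Finset.sum_nonneg fun j _ =>
      mul_nonneg (mul_nonneg (hw i) (hw j)) ?_
    rcases le_total (r i) (r j) with hij | hij
    · exact mul_nonneg_of_nonpos_of_nonpos
        (sub_nonpos.2 (pow_le_pow_left₀ (hr i) hij a)) (sub_nonpos.2 (pow_le_pow_left₀ (hr i) hij b))
    · exact mul_nonneg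
        (sub_nonneg.2 (pow_le_pow_left₀ (hr j) hij a)) (sub_nonneg.2 (pow_le_pow_left₀ (hr j) hij b))
  have e : ∑ i, ∑ j, w i * w j * ((r i ^ a - r j ^ a) * (r i ^ b - r j ^ b)) =
      2 * ((∑ i, w i) * ∑ i, r i ^ (a + b) * w i) -
        2 * ((∑ i, r i ^ a * w i) * (∑ i, r i ^ b * w i)) := by
    have : ∀ i j, w i * w j * ((r i ^ a - r j ^ a) * (r i ^ b - r j ^ b)) =
        (r i ^ (a + b) * w i) * w j + w i * (r j ^ (a + b) * w j)
        - (r i ^ a * w i) * (r j ^ b * w j) - (r i ^ b * w i) * (r j ^ a * w j) := by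
      intro i j; ring
    simp only [this, Finset.sum_sub_distrib, Finset.sum_add_distrib, ← Finset.mul_sum,
      ← Finset.sum_mul]
    ring
  linarith

/-! ### Rank one perturbation of the trace potential -/

section RankOne

variable {d : ℕ}

/-- The Sherman–Morrison correction of `R = B⁻¹` for a rank one update of `B`. -/
lemma inv_add_smul_vecMulVec {B : Matrix (Fin d) (Fin d) ℝ} (hB : IsUnit B.det) (hsymm : Bᵀ = B)
    (v : Fin d → ℝ) {x : ℝ} (hα : 0 < 1 + x * (v ⬝ᵥ (B⁻¹ *ᵥ v))) :
    (B + x • vecMulVec v v)⁻¹ = B⁻¹ - (x / (1 + x * (v ⬝ᵥ (B⁻¹ *ᵥ v)))) •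
      vecMulVec (B⁻¹ *ᵥ v) (B⁻¹ *ᵥ v) := by
  set α := v ⬝ᵥ (B⁻¹ *ᵥ v) with hαdef
  have hs : v ᵥ* B⁻¹ = B⁻¹ *ᵥ v := by
    rw [← mulVec_transpose, transpose_nonsing_inv, hsymm]
  have hBB : B *ᵥ (B⁻¹ *ᵥ v) = v := by rw [mulVec_mulVec, mul_nonsing_inv _ hB, one_mulVec]
  refine inv_eq_right_inv ?_
  rw [add_mul, mul_sub, mul_sub, mul_nonsing_inv _ hB, Matrix.mul_smul, mul_vecMulVec, hBB,
    Matrix.smul_mul, vecMulVec_mul, hs, Matrix.smul_mul, Matrix.mul_smul, vecMulVec_mul_vecMulVec,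
    ← hαdef]
  ext i j
  simp only [Matrix.add_apply, Matrix.sub_apply, Matrix.smul_apply, vecMulVec_apply, Pi.smul_apply, smul_eq_mul]
  field_simp
  ring

/-- Mixed moments of a symmetric matrix and its rank one downdate. -/
lemma dotProduct_pow_mul_pow_bounds {R R' : Matrix (Fin d) (Fin d) ℝ} {v : Fin d → ℝ}
    (hR : Rᵀ = R) {s x l u : ℝ}
    (hR' : R' = R - s • vecMulVec (R *ᵥ v) (R *ᵥ v)) (hs0 : 0 ≤ s) (hsx : s ≤ x) (hu : 0 < u)
    (h0 : ∀ m, 0 ≤ v ⬝ᵥ (R ^ m *ᵥ v))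
    (hmul : ∀ a b, (v ⬝ᵥ (R ^ a *ᵥ v)) * (v ⬝ᵥ (R ^ b *ᵥ v)) ≤ l * (v ⬝ᵥ (R ^ (a + b) *ᵥ v)))
    (hsucc : ∀ m, v ⬝ᵥ (R ^ (m + 1) *ᵥ v) ≤ u⁻¹ * (v ⬝ᵥ (R ^ m *ᵥ v))) (hl : 0 ≤ l) (k : ℕ)
    (hk : k * (x * l / u) ≤ 1) (j : ℕ) :
    (1 - k * (x * l / u)) * (v ⬝ᵥ (R ^ (k + j) *ᵥ v)) ≤ v ⬝ᵥ (R' ^ k *ᵥ (R ^ j *ᵥ v)) ∧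
      v ⬝ᵥ (R' ^ k *ᵥ (R ^ j *ᵥ v)) ≤ v ⬝ᵥ (R ^ (k + j) *ᵥ v) := by
  have hδ : 0 ≤ x * l / u := by have := hs0.trans hsx; positivity
  induction k generalizing j with
  | zero => simp
  | succ k ih =>
    have hk' : k * (x * l / u) ≤ 1 := by push_cast at hk; linarith
    -- Peel off the innermost R': it acts as R up to a multiple of Rv, so both resulting terms are
    -- mixed moments with exponent k.
    have hrec : v ⬝ᵥ (R' ^ (k + 1) *ᵥ (R ^ j *ᵥ v)) = v ⬝ᵥ (R' ^ k *ᵥ (R ^ (j + 1) *ᵥ v)) -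
        s * (v ⬝ᵥ (R ^ (j + 1) *ᵥ v)) * (v ⬝ᵥ (R' ^ k *ᵥ (R ^ 1 *ᵥ v))) := by
      have e1 : R' *ᵥ (R ^ j *ᵥ v) = R ^ (j + 1) *ᵥ v -
          (s * (v ⬝ᵥ (R ^ (j + 1) *ᵥ v))) • (R ^ 1 *ᵥ v) := by
        have e2 : (R *ᵥ v) ⬝ᵥ (R ^ j *ᵥ v) = v ⬝ᵥ (R ^ (j + 1) *ᵥ v) := by
          rw [pow_succ', ← mulVec_mulVec, dotProduct_mulVec v, ← mulVec_transpose, hR]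
        rw [hR', sub_mulVec, smul_mulVec, vecMulVec_mulVec, e2, mulVec_mulVec, ← pow_succ', pow_one,
          op_smul_eq_smul, smul_smul]
      rw [pow_succ, ← mulVec_mulVec, e1, mulVec_sub, mulVec_smul, dotProduct_sub, dotProduct_smul,
        smul_eq_mul]
    obtain ⟨a1, a2⟩ := ih hk' (j + 1)
    obtain ⟨b1, b2⟩ := ih hk' 1
    have b0 : 0 ≤ v ⬝ᵥ (R' ^ k *ᵥ (R ^ 1 *ᵥ v)) :=
      (mul_nonneg (sub_nonneg.2 hk') (h0 _)).trans b1
    have eidx : k + (j + 1) = k + 1 + j := by ring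
    rw [eidx] at a1 a2
    -- The association inequality merges the two moments into one of index k + j + 2, and the
    -- spectral gap u lowers the index by one: each peeling costs at most a fraction xl/u.
    have c1 : s * (v ⬝ᵥ (R ^ (j + 1) *ᵥ v)) * (v ⬝ᵥ (R' ^ k *ᵥ (R ^ 1 *ᵥ v))) ≤
        x * l / u * (v ⬝ᵥ (R ^ (k + 1 + j) *ᵥ v)) := by
      calc s * (v ⬝ᵥ (R ^ (j + 1) *ᵥ v)) * (v ⬝ᵥ (R' ^ k *ᵥ (R ^ 1 *ᵥ v)))
          ≤ s * (v ⬝ᵥ (R ^ (j + 1) *ᵥ v)) * (v ⬝ᵥ (R ^ (k + 1) *ᵥ v)) :=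
            mul_le_mul_of_nonneg_left b2 (mul_nonneg hs0 (h0 _))
        _ = s * ((v ⬝ᵥ (R ^ (j + 1) *ᵥ v)) * (v ⬝ᵥ (R ^ (k + 1) *ᵥ v))) := by ring
        _ ≤ s * (l * (v ⬝ᵥ (R ^ (k + 1 + j + 1) *ᵥ v))) := by
            refine mul_le_mul_of_nonneg_left ((hmul _ _).trans_eq ?_) hs0
            congr 4; ring
        _ ≤ s * (l * (u⁻¹ * (v ⬝ᵥ (R ^ (k + 1 + j) *ᵥ v)))) :=
            mul_le_mul_of_nonneg_left (mul_le_mul_of_nonneg_left (hsucc _) hl) hs0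
        _ = s * (l * u⁻¹ * (v ⬝ᵥ (R ^ (k + 1 + j) *ᵥ v))) := by ring
        _ ≤ x * (l * u⁻¹ * (v ⬝ᵥ (R ^ (k + 1 + j) *ᵥ v))) :=
            mul_le_mul_of_nonneg_right hsx (mul_nonneg (by positivity) (h0 _))
        _ = _ := by rw [div_eq_mul_inv]; ring
    have c0 : 0 ≤ s * (v ⬝ᵥ (R ^ (j + 1) *ᵥ v)) * (v ⬝ᵥ (R' ^ k *ᵥ (R ^ 1 *ᵥ v))) :=
      mul_nonneg (mul_nonneg hs0 (h0 _)) b0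
    rw [hrec]
    push_cast
    constructor
    · nlinarith
    · linarith

/-- Telescoping the trace of powers along a rank one downdate. -/
lemma trace_pow_sub_trace_pow {R R' : Matrix (Fin d) (Fin d) ℝ} {v : Fin d → ℝ}
    (hR : Rᵀ = R) {s b x : ℝ} (hR' : R' = R - s • vecMulVec (R *ᵥ v) (R *ᵥ v))
    (hv : R *ᵥ v = b • (R' *ᵥ v)) (hx : s * b = x) (q : ℕ) :
    (R ^ q).trace - (R' ^ q).trace =
      x * ∑ k ∈ Finset.range q, v ⬝ᵥ (R' ^ (k + 1) *ᵥ (R ^ (q - k) *ᵥ v)) := by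
  have hR't : R'ᵀ = R' := by
    rw [hR', transpose_sub, transpose_smul, transpose_vecMulVec, hR]
  -- Consecutive terms Tr(R'^k R^(q-k)) differ through the rank one matrix R − R' = s(Rv)(Rv)ᵀ.
  -- Trading one Rv for b·R'v turns s into sb = x.
  have step : ∀ k ∈ Finset.range q, (R' ^ k * R ^ (q - k)).trace -
      (R' ^ (k + 1) * R ^ (q - (k + 1))).trace =
      x * (v ⬝ᵥ (R' ^ (k + 1) *ᵥ (R ^ (q - k) *ᵥ v))) := by
    intro k hk
    obtain ⟨m, rfl⟩ : ∃ m, q = k + 1 + m := Nat.exists_eq_add_of_le (Finset.mem_range.1 hk)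
    have i1 : k + 1 + m - k = m + 1 := by omega
    have i2 : k + 1 + m - (k + 1) = m := by omega
    rw [i1, i2]
    have e1 : R' ^ k * R ^ (m + 1) - R' ^ (k + 1) * R ^ m =
        s • vecMulVec (R' ^ k *ᵥ (R *ᵥ v)) ((R *ᵥ v) ᵥ* R ^ m) := by
      rw [pow_succ', pow_succ, ← Matrix.mul_assoc, ← sub_mul, ← mul_sub, hR', sub_sub_cancel,
        ← hR', Matrix.mul_smul, Matrix.smul_mul, mul_vecMulVec, vecMulVec_mul]
    rw [← trace_sub, e1, trace_smul, trace_vecMulVec, hv, mulVec_smul, ← hv, smul_dotProduct,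
      ← mulVec_transpose, transpose_pow, hR, mulVec_mulVec, mulVec_mulVec, ← pow_succ, ← pow_succ,
      dotProduct_mulVec v, ← mulVec_transpose, transpose_pow, hR't, smul_eq_mul, smul_eq_mul,
      ← mul_assoc, hx]
  have := Finset.sum_range_sub' (fun k => (R' ^ k * R ^ (q - k)).trace) q
  rw [Finset.mul_sum, ← Finset.sum_congr rfl step, this]
  simp

/-- Two-sided control of the trace of an inverse power under a small rank one update. -/
lemma trace_inv_pow_add_smul_vecMulVec {B : Matrix (Fin d) (Fin d) ℝ} (hB : B.IsHermitian) {u : ℝ}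
    (hu0 : 0 < u) (hu : ∀ z, u * (z ⬝ᵥ z) ≤ z ⬝ᵥ (B *ᵥ z)) (v : Fin d → ℝ) {x : ℝ} (hx : 0 ≤ x)
    (q : ℕ) (hq : q * (x * (v ⬝ᵥ v) / u) ≤ 1 / 2) :
    (B⁻¹ ^ q).trace - x * (q * (v ⬝ᵥ (B⁻¹ ^ (q + 1) *ᵥ v))) ≤
        ((B + x • vecMulVec v v)⁻¹ ^ q).trace ∧
      ((B + x • vecMulVec v v)⁻¹ ^ q).trace ≤
        (B⁻¹ ^ q).trace - x / 2 * (q * (v ⬝ᵥ (B⁻¹ ^ (q + 1) *ᵥ v))) := by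
  have hsymm : Bᵀ = B := by simpa [IsHermitian] using hB
  obtain ⟨W, l, h1, h2, hBW, hl⟩ := exists_spectral_decomposition_of_le hB hu
  have hl0 : ∀ i, 0 < l i := fun i => hu0.trans_le (hl i)
  have hr0 : ∀ i, 0 ≤ (l i)⁻¹ := fun i => inv_nonneg.2 (hl0 i).le
  have hμ : ∀ m, v ⬝ᵥ (B⁻¹ ^ m *ᵥ v) = ∑ i, (l i)⁻¹ ^ m * (Wᵀ *ᵥ v) i ^ 2 := by
    intro m
    rw [hBW, inv_pow_conj_diagonal h1 h2 hl0, dotProduct_conj_diagonal_mulVec]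
  have h0 : ∀ m, 0 ≤ v ⬝ᵥ (B⁻¹ ^ m *ᵥ v) := fun m => by
    rw [hμ]
    exact Finset.sum_nonneg fun i _ => mul_nonneg (pow_nonneg (hr0 i) _) (sq_nonneg _)
  have hmul : ∀ a b, (v ⬝ᵥ (B⁻¹ ^ a *ᵥ v)) * (v ⬝ᵥ (B⁻¹ ^ b *ᵥ v)) ≤
      (v ⬝ᵥ v) * (v ⬝ᵥ (B⁻¹ ^ (a + b) *ᵥ v)) := fun a b => by
    rw [hμ, hμ, hμ, ← sum_sq_transpose_mulVec h1]
    exact sum_pow_mul_sum_pow_le hr0 (fun i => sq_nonneg _) a b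
  have hsucc : ∀ m, v ⬝ᵥ (B⁻¹ ^ (m + 1) *ᵥ v) ≤ u⁻¹ * (v ⬝ᵥ (B⁻¹ ^ m *ᵥ v)) := fun m => by
    rw [hμ, hμ, Finset.mul_sum]
    refine Finset.sum_le_sum fun i _ => ?_
    rw [pow_succ', mul_assoc]
    exact mul_le_mul_of_nonneg_right (inv_anti₀ hu0 (hl i))
      (mul_nonneg (pow_nonneg (hr0 i) _) (sq_nonneg _))
  have hdet : IsUnit B.det := by
    rw [← isUnit_iff_isUnit_det]
    have hinv : B * (W * diagonal (fun i => (l i)⁻¹) * Wᵀ) = 1 := by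
      calc B * (W * diagonal (fun i => (l i)⁻¹) * Wᵀ)
          = W * diagonal l * (Wᵀ * W) * diagonal (fun i => (l i)⁻¹) * Wᵀ := by
            rw [hBW]; simp only [Matrix.mul_assoc]
        _ = W * Wᵀ := by
            rw [h2, Matrix.mul_one, Matrix.mul_assoc W, diagonal_mul_diagonal]
            have : (fun i => l i * (l i)⁻¹) = fun _ => (1 : ℝ) :=
              funext fun i => mul_inv_cancel₀ (hl0 i).ne'
            rw [this, diagonal_one, Matrix.mul_one]
        _ = 1 := h1
    exact IsUnit.of_mul_eq_one _ hinv
  have hα0 : 0 ≤ v ⬝ᵥ (B⁻¹ *ᵥ v) := by simpa using h0 1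
  have hb : 0 < 1 + x * (v ⬝ᵥ (B⁻¹ *ᵥ v)) := by positivity
  have hR' := inv_add_smul_vecMulVec hdet hsymm v hb
  set R' := (B + x • vecMulVec v v)⁻¹ with hR'def
  set b := 1 + x * (v ⬝ᵥ (B⁻¹ *ᵥ v)) with hbdef
  have hR : (B⁻¹)ᵀ = B⁻¹ := by rw [transpose_nonsing_inv, hsymm]
  have hv : B⁻¹ *ᵥ v = b • (R' *ᵥ v) := by
    rw [hR', sub_mulVec, smul_mulVec, vecMulVec_mulVec, op_smul_eq_smul, smul_smul,
      dotProduct_comm (B⁻¹ *ᵥ v) v, smul_sub, smul_smul, ← sub_smul]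
    have : b - b * (x / b * (v ⬝ᵥ (B⁻¹ *ᵥ v))) = 1 := by
      field_simp
      rw [hbdef]; ring
    rw [this, one_smul]
  have htr := trace_pow_sub_trace_pow hR hR' hv (div_mul_cancel₀ x hb.ne') q
  have hδ : 0 ≤ x * (v ⬝ᵥ v) / u := by
    have : 0 ≤ v ⬝ᵥ v := by simpa using h0 0
    positivity
  have hs : x / b ≤ x := div_le_self hx (by rw [hbdef]; nlinarith [mul_nonneg hx hα0])
  -- Every telescoping term has total exponent q + 1, so all are compared with the same moment; the
  -- smallness of q·x|v|²/u keeps the lost fraction below 1/2.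
  have bounds : ∀ k ∈ Finset.range q, 1 / 2 * (v ⬝ᵥ (B⁻¹ ^ (q + 1) *ᵥ v)) ≤
      v ⬝ᵥ (R' ^ (k + 1) *ᵥ (B⁻¹ ^ (q - k) *ᵥ v)) ∧
      v ⬝ᵥ (R' ^ (k + 1) *ᵥ (B⁻¹ ^ (q - k) *ᵥ v)) ≤ v ⬝ᵥ (B⁻¹ ^ (q + 1) *ᵥ v) := by
    intro k hk
    have hkq : k + 1 ≤ q := Finset.mem_range.1 hk
    have hk1 : ((k + 1 : ℕ) : ℝ) * (x * (v ⬝ᵥ v) / u) ≤ 1 / 2 :=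
      (mul_le_mul_of_nonneg_right (Nat.cast_le.2 hkq) hδ).trans hq
    have := dotProduct_pow_mul_pow_bounds hR hR' (div_nonneg hx hb.le) hs hu0 h0 hmul hsucc
      (by simpa using h0 0) (k + 1) (by linarith) (q - k)
    have e : k + 1 + (q - k) = q + 1 := by omega
    rw [e] at this
    exact ⟨le_trans (mul_le_mul_of_nonneg_right (by linarith) (h0 _)) this.1, this.2⟩
  have s1 := Finset.sum_le_sum fun k hk => (bounds k hk).1
  have s2 := Finset.sum_le_sum fun k hk => (bounds k hk).2
  simp only [Finset.sum_const, Finset.card_range, nsmul_eq_mul] at s1 s2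
  have t1 := mul_le_mul_of_nonneg_left s1 hx
  have t2 := mul_le_mul_of_nonneg_left s2 hx
  constructor <;> linarith

end RankOne

/-! ### Independent selection: coordinatewise replacement and Markov's inequality -/

section Selection

variable {n : ℕ}

/-- Resampling a single coordinate of a product of Bernoulli measures. -/
lemma integral_pi_bernoulli_update (p : Fin n → unitInterval) (i : Fin n)
    (F : (Fin n → Bool) → ℝ) :
    ∫ ω, F ω ∂(Measure.pi fun i => ProbabilityTheory.bernoulliMeasure true false (p i)) =
      ∫ ω, ((p i : ℝ) * F (Function.update ω i true) + (1 - p i) * F (Function.update ω i false))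
        ∂(Measure.pi fun i => ProbabilityTheory.bernoulliMeasure true false (p i)) := by
  classical
  set w : Fin n → Bool → ℝ := fun j b => if b then (p j : ℝ) else 1 - p j with hw
  have hreal : ∀ ω, (Measure.pi fun i =>
      ProbabilityTheory.bernoulliMeasure true false (p i)).real {ω} = ∏ j, w j (ω j) := by
    intro ω
    rw [measureReal_def, Measure.pi_singleton, ENNReal.toReal_prod]
    refine Finset.prod_congr rfl fun j _ => ?_
    rw [← measureReal_def,
      ProbabilityTheory.bernoulliMeasure_real_apply _ (measurableSet_singleton _)]
    cases ω j <;> simp [hw]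
  rw [integral_fintype Integrable.of_finite, integral_fintype Integrable.of_finite]
  simp only [hreal, smul_eq_mul]
  -- Flipping coordinate i is an involution; reindexing by it moves the flip from F to the
  -- probability weights, which then sum to 1 in that coordinate.
  let σ : (Fin n → Bool) → (Fin n → Bool) := fun ω => Function.update ω i (!ω i)
  have hσ : Function.Involutive σ := fun ω => by simp [σ]
  have hV : ∀ ω : Fin n → Bool, ∏ j, w j (ω j) = w i (ω i) * ∏ j ∈ Finset.univ.erase i, w j (ω j) := fun ω =>
    (Finset.mul_prod_erase _ _ (Finset.mem_univ i)).symm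
  have hVσ : ∀ ω : Fin n → Bool, ∏ j ∈ Finset.univ.erase i, w j (σ ω j) =
      ∏ j ∈ Finset.univ.erase i, w j (ω j) := fun ω =>
    Finset.prod_congr rfl fun j hj => by
      simp only [σ]; rw [Function.update_of_ne (Finset.ne_of_mem_erase hj)]
  have hF : ∀ ω : Fin n → Bool, (p i : ℝ) * F (Function.update ω i true) +
      (1 - p i) * F (Function.update ω i false) =
      w i (ω i) * F ω + w i (!ω i) * F (σ ω) := by
    intro ω
    cases h : ω i
    · have : Function.update ω i false = ω := by rw [← h, Function.update_eq_self]
      simp [hw, σ, h, this, add_comm]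
    · have : Function.update ω i true = ω := by rw [← h, Function.update_eq_self]
      simp [hw, σ, h, this]
  simp only [hF, mul_add, Finset.sum_add_distrib]
  have hre : ∑ ω, (∏ j, w j (ω j)) * (w i (!ω i) * F (σ ω)) =
      ∑ ω, (∏ j, w j (σ ω j)) * (w i (ω i) * F ω) := by
    refine Finset.sum_bij' (fun ω _ => σ ω) (fun ω _ => σ ω) (by simp) (by simp)
      (fun ω _ => hσ ω) (fun ω _ => hσ ω) ?_
    intro ω _
    rw [hσ ω]
    simp [σ]
  rw [hre, ← Finset.sum_add_distrib]
  refine Finset.sum_congr rfl fun ω _ => ?_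
  rw [hV, hV, hVσ]
  have h1 : w i (ω i) + w i (σ ω i) = 1 := by
    cases h : ω i <;> simp [hw, σ, h]
  linear_combination (-(w i (ω i)) * (∏ j ∈ Finset.univ.erase i, w j (ω j)) * F ω) * h1

/-- Replacing the independent random weights one at a time by deterministic ones. -/
lemma integral_pi_bernoulli_le (p : Fin n → unitInterval) {y a e : Fin n → ℝ} (hy : ∀ i, 0 ≤ y i)
    (ha : ∀ i, 0 ≤ a i) (G : (Fin n → ℝ) → ℝ)
    (hstep : ∀ i x, (∀ j, 0 ≤ x j) →
      (p i : ℝ) * G (Function.update x i (y i)) + (1 - p i) * G (Function.update x i 0) ≤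
        G (Function.update x i (a i)) + e i) :
    ∫ ω, G (fun i => if ω i = true then y i else 0)
      ∂(Measure.pi fun i => ProbabilityTheory.bernoulliMeasure true false (p i)) ≤
        G a + ∑ i, e i := by
  classical
  set μ := Measure.pi fun i => ProbabilityTheory.bernoulliMeasure true false (p i) with hμ
  -- Hybrid weights: random on s, deterministic off s.
  let z : Finset (Fin n) → (Fin n → Bool) → Fin n → ℝ := fun s ω j =>
    if j ∈ s then (if ω j = true then y j else 0) else a j
  have hz : ∀ s ω j, 0 ≤ z s ω j := by
    intro s ω j
    simp only [z]
    split_ifs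
    exacts [hy j, le_rfl, ha j]
  have main : ∀ s : Finset (Fin n), ∫ ω, G (z s ω) ∂μ ≤ G a + ∑ i ∈ s, e i := by
    intro s
    induction s using Finset.induction_on with
    | empty => simp [z]
    | insert i s hi ih =>
      have hz' : ∀ ω b, z (insert i s) (Function.update ω i b) =
          Function.update (z s ω) i (if b = true then y i else 0) := by
        intro ω b
        ext j
        by_cases hj : j = i
        · subst hj; simp [z]
        · simp [z, hj]
      have hzi : ∀ ω, Function.update (z s ω) i (a i) = z s ω := by
        intro ω
        have : a i = z s ω i := by simp [z, hi]
        rw [this, Function.update_eq_self]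
      rw [hμ, integral_pi_bernoulli_update p i, ← hμ, Finset.sum_insert hi]
      calc _ ≤ ∫ ω, (G (z s ω) + e i) ∂μ := by
            refine integral_mono Integrable.of_finite Integrable.of_finite fun ω => ?_
            have := hstep i (z s ω) (hz s ω)
            rw [hzi] at this
            simpa [hz'] using this
        _ = ∫ ω, G (z s ω) ∂μ + e i := by
            rw [integral_add Integrable.of_finite Integrable.of_finite]; simp
        _ ≤ _ := by linarith
  simpa [z] using main Finset.univ

/-- Markov's inequality on a finite probability space, strict form allowing mean zero. -/
lemma measureReal_lt_le_of_integral_le {Ω : Type*} [Finite Ω] [MeasurableSpace Ω]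
    [DiscreteMeasurableSpace Ω] (μ : Measure Ω) [IsProbabilityMeasure μ] {F : Ω → ℝ}
    (hF : ∀ ω, 0 ≤ F ω) {m t : ℝ} (ht : 0 < t) (hm : ∫ ω, F ω ∂μ ≤ m) :
    μ.real {ω | t * m < F ω} ≤ t⁻¹ := by
  have hint : Integrable F μ := Integrable.of_finite
  have hm0 : 0 ≤ m := (integral_nonneg hF).trans hm
  -- The case m = 0 occurs when the least squares residual vanishes.
  rcases hm0.eq_or_lt with h | h
  · have h0 : ∫ ω, F ω ∂μ = 0 := le_antisymm (hm.trans_eq h.symm) (integral_nonneg hF)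
    have hae := (integral_eq_zero_iff_of_nonneg hF hint).1 h0
    have : μ.real {ω | t * m < F ω} = 0 := by
      rw [measureReal_def, ENNReal.toReal_eq_zero_iff]
      left
      refine measure_mono_null ?_ (ae_iff.1 hae)
      intro ω hω
      simp only [Set.mem_ofPred_eq, ← h, mul_zero] at hω
      exact hω.ne'
    rw [this]; positivity
  · have h1 := mul_meas_ge_le_integral_of_nonneg (Filter.Eventually.of_forall hF) hint (t * m)
    have h2 : μ.real {ω | t * m < F ω} ≤ μ.real {ω | t * m ≤ F ω} :=
      measureReal_mono fun ω (hω : t * m < F ω) => hω.le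
    have h3 : t * m * μ.real {ω | t * m < F ω} ≤ m :=
      (mul_le_mul_of_nonneg_left h2 (by positivity)).trans (h1.trans hm)
    rw [← one_div, le_div_iff₀ ht]
    have : m * (μ.real {ω | t * m < F ω} * t) ≤ m * 1 := by linarith
    exact le_of_mul_le_mul_left this h

end Selection

/-! ### The two probabilistic estimates for leverage score sampling -/

section Sampling

variable {n d : ℕ}

lemma leverageScore_eq (U : Matrix (Fin n) (Fin d) ℝ) (i : Fin n) :
    leverageScore U i = U i ⬝ᵥ U i := by
  rw [leverageScore, EuclideanSpace.real_norm_sq_eq]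
  simp [dotProduct, pow_two]

lemma coe_samplingProb (U : Matrix (Fin n) (Fin d) ℝ) (c : ℕ) (i : Fin n) :
    (samplingProb U c i : ℝ) = min 1 ((c : ℝ) / d * (U i ⬝ᵥ U i)) := by
  simp only [samplingProb, leverageScore_eq]
  congr 1
  ring

/-- The reweighting of the `i`-th squared residual in the sampled problem. -/
def samplingWeight (U : Matrix (Fin n) (Fin d) ℝ) (c : ℕ) (ω : Fin n → Bool) (i : Fin n) : ℝ :=
  if ω i = true then (samplingProb U c i : ℝ)⁻¹ else 0

/-- The matrix `∑ xᵢ u⁽ⁱ⁾ u⁽ⁱ⁾ᵀ + 1 / 4`. -/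
def shiftedGram (U : Matrix (Fin n) (Fin d) ℝ) (x : Fin n → ℝ) : Matrix (Fin d) (Fin d) ℝ :=
  (1 / 4 : ℝ) • (1 : Matrix (Fin d) (Fin d) ℝ) + ∑ i, x i • vecMulVec (U i) (U i)

lemma shiftedGram_isHermitian (U : Matrix (Fin n) (Fin d) ℝ) (x : Fin n → ℝ) :
    (shiftedGram U x).IsHermitian := by
  simp [shiftedGram, IsHermitian, transpose_vecMulVec, transpose_sum]

lemma dotProduct_shiftedGram_mulVec (U : Matrix (Fin n) (Fin d) ℝ) (x : Fin n → ℝ)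
    (z : Fin d → ℝ) :
    z ⬝ᵥ (shiftedGram U x *ᵥ z) = 1 / 4 * (z ⬝ᵥ z) + ∑ i, x i * (U i ⬝ᵥ z) ^ 2 := by
  rw [shiftedGram, add_mulVec, dotProduct_add, smul_mulVec, one_mulVec, dotProduct_smul,
    sum_mulVec, dotProduct_sum, smul_eq_mul]
  congr 1
  refine Finset.sum_congr rfl fun i _ => ?_
  rw [smul_mulVec, vecMulVec_mulVec, op_smul_eq_smul, dotProduct_smul, dotProduct_smul, smul_eq_mul,
    smul_eq_mul, dotProduct_comm z]
  ring

lemma le_dotProduct_shiftedGram_mulVec (U : Matrix (Fin n) (Fin d) ℝ) {x : Fin n → ℝ}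
    (hx : ∀ i, 0 ≤ x i) (z : Fin d → ℝ) :
    1 / 4 * (z ⬝ᵥ z) ≤ z ⬝ᵥ (shiftedGram U x *ᵥ z) := by
  rw [dotProduct_shiftedGram_mulVec]
  have := Finset.sum_nonneg fun i (_ : i ∈ Finset.univ) => mul_nonneg (hx i) (sq_nonneg (U i ⬝ᵥ z))
  linarith

/-- Changing one weight is a rank one update of a matrix not involving that row, the form required
by the trace bounds. -/
lemma shiftedGram_update (U : Matrix (Fin n) (Fin d) ℝ) (x : Fin n → ℝ) (i : Fin n) (t : ℝ) :
    shiftedGram U (Function.update x i t) =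
      shiftedGram U (Function.update x i 0) + t • vecMulVec (U i) (U i) := by
  classical
  have key : ∀ s : ℝ, ∑ j, Function.update x i s j • vecMulVec (U j) (U j) =
      s • vecMulVec (U i) (U i) + ∑ j ∈ Finset.univ.erase i, x j • vecMulVec (U j) (U j) := by
    intro s
    rw [← Finset.add_sum_erase _ _ (Finset.mem_univ i), Function.update_self]
    congr 1
    exact Finset.sum_congr rfl fun j hj => by
      rw [Function.update_of_ne (Finset.ne_of_mem_erase hj)]
  rw [shiftedGram, shiftedGram, key, key, zero_smul]
  abel

lemma sum_sq_dotProduct_row {U : Matrix (Fin n) (Fin d) ℝ} (hU : Uᵀ * U = 1) (z : Fin d → ℝ) :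
    ∑ i, (U i ⬝ᵥ z) ^ 2 = z ⬝ᵥ z := by
  have : (U *ᵥ z) ⬝ᵥ (U *ᵥ z) = z ⬝ᵥ z := by
    rw [dotProduct_mulVec, ← mulVec_transpose, mulVec_mulVec, hU, one_mulVec]
  rw [← this]
  simp [dotProduct, mulVec, pow_two]

/-- The expected trace of the inverse power of the sampled Gram matrix. -/
lemma integral_trace_inv_pow_le {U : Matrix (Fin n) (Fin d) ℝ} (hU : Uᵀ * U = 1) {c q : ℕ}
    (hd : 0 < d) (hc : 0 < c) (hq : 8 * (q : ℝ) ≤ c / d) :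
    ∫ ω, ((shiftedGram U (samplingWeight U c ω))⁻¹ ^ q).trace ∂(selectionLaw U c) ≤
      d * (4 / 3 : ℝ) ^ q := by
  have hd' : (0 : ℝ) < d := Nat.cast_pos.2 hd
  have hc' : (0 : ℝ) < c := Nat.cast_pos.2 hc
  set K : ℝ := c / d with hK
  have hK0 : 0 < K := by positivity
  set p := samplingProb U c with hp
  have hp0 : ∀ i, 0 ≤ (p i : ℝ) := fun i => (p i).2.1
  -- If pᵢ = 1 the weight is already the constant 1 and nothing needs comparing; this leaves only
  -- rows with pᵢ = K·lᵢ, whose leverage is small.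
  let a : Fin n → ℝ := fun i => if (p i : ℝ) = 1 then 1 else 1 / 2
  have ha : ∀ i, 1 / 2 ≤ a i := fun i => by simp only [a]; split_ifs <;> norm_num
  have step := integral_pi_bernoulli_le p (y := fun i => (p i : ℝ)⁻¹) (a := a) (e := fun _ => 0)
    (fun i => inv_nonneg.2 (hp0 i)) (fun i => by linarith [ha i])
    (fun x => ((shiftedGram U x)⁻¹ ^ q).trace) (by
      intro i x hx
      by_cases h1 : (p i : ℝ) = 1
      · have hai : a i = 1 := if_pos h1
        simp [hai, h1]
      have hpi : (p i : ℝ) = K * (U i ⬝ᵥ U i) := by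
        have h := coe_samplingProb U c i
        rw [← hp, ← hK] at h
        rcases min_choice 1 (K * (U i ⬝ᵥ U i)) with h2 | h2
        · exact absurd (h.trans h2) h1
        · exact h.trans h2
      have hlt : (p i : ℝ) ≤ 1 := (p i).2.2
      have hx0 : ∀ j, 0 ≤ Function.update x i 0 j := fun j => by
        by_cases hj : j = i
        · subst hj; simp
        · simp [hj, hx j]
      set l := U i ⬝ᵥ U i with hl
      set B := shiftedGram U (Function.update x i 0) with hB
      have hB1 : B.IsHermitian := shiftedGram_isHermitian _ _
      have hB2 := le_dotProduct_shiftedGram_mulVec U hx0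
      rw [shiftedGram_update U x i (p i : ℝ)⁻¹, shiftedGram_update U x i (a i), ← hB]
      have hai : a i = 1 / 2 := if_neg h1
      have hql : q * l ≤ 1 / 8 := by
        have : 8 * (q : ℝ) * l ≤ K * l := mul_le_mul_of_nonneg_right hq (by
          by_contra hneg
          have : K * l < 0 := mul_neg_of_pos_of_neg hK0 (not_le.1 hneg)
          linarith [hp0 i])
        linarith
      -- With μ = vᵀB^{-(q+1)}v, the weight 1/2 lowers the trace by at most qμ/2. The weight 1/p
      -- lowers it by at least qμ/(2p), which is again qμ/2 after averaging.
      have low := (trace_inv_pow_add_smul_vecMulVec hB1 (by norm_num) hB2 (U i)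
        (x := a i) (by rw [hai]; norm_num) q (by rw [hai, ← hl]; linarith)).1
      rcases (hp0 i).eq_or_lt with h0 | h0
      · have hl0 : l = 0 := by
          have : K * l = 0 := by rw [← hpi, ← h0]
          exact (mul_eq_zero.1 this).resolve_left hK0.ne'
        have hv : U i = 0 := dotProduct_self_eq_zero.1 hl0
        simp only [hv, zero_vecMulVec, smul_zero, add_zero]
        linarith
      · have up := (trace_inv_pow_add_smul_vecMulVec hB1 (by norm_num) hB2 (U i)
          (x := (p i : ℝ)⁻¹) (inv_nonneg.2 (hp0 i)) q (by
            have hl0 : 0 < l := by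
              rw [hpi] at h0
              exact pos_of_mul_pos_right h0 hK0.le
            -- Here x·l = 1/K and the lower bound is u = 1/4, so the smallness condition reads 4q/K
            -- ≤ 1/2, which is `hq`.
            rw [← hl, hpi, mul_inv, mul_assoc, inv_mul_cancel₀ hl0.ne', mul_one]
            have : q * (K⁻¹ / (1 / 4)) = 4 * q / K := by ring
            rw [this, div_le_iff₀ hK0]
            linarith)).2
        rw [hai] at low ⊢
        set μ := U i ⬝ᵥ (B⁻¹ ^ (q + 1) *ᵥ U i)
        have e1 := mul_le_mul_of_nonneg_left up h0.le
        have e2 : (p i : ℝ) * ((B⁻¹ ^ q).trace - (p i : ℝ)⁻¹ / 2 * (q * μ)) =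
            p i * (B⁻¹ ^ q).trace - 1 / 2 * (q * μ) := by
          field_simp
        rw [e2] at e1
        linarith)
  have h34 : ∀ z, 3 / 4 * (z ⬝ᵥ z) ≤ z ⬝ᵥ (shiftedGram U a *ᵥ z) := by
    intro z
    rw [dotProduct_shiftedGram_mulVec]
    have : 1 / 2 * (z ⬝ᵥ z) ≤ ∑ i, a i * (U i ⬝ᵥ z) ^ 2 := by
      rw [← sum_sq_dotProduct_row hU z, Finset.mul_sum]
      exact Finset.sum_le_sum fun i _ => mul_le_mul_of_nonneg_right (ha i) (sq_nonneg _)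
    linarith
  have init := trace_inv_pow_le (shiftedGram_isHermitian U a) (by norm_num) h34 q
  rw [inv_div] at init
  simp only [Finset.sum_const_zero, add_zero] at step
  exact step.trans init

/-- Leverage score sampling is a subspace embedding from below. -/
lemma measureReal_not_embedding_le {U : Matrix (Fin n) (Fin d) ℝ} (hU : Uᵀ * U = 1) {c q : ℕ}
    (hd : 0 < d) (hc : 0 < c) (hq0 : q ≠ 0) (hq : 8 * (q : ℝ) ≤ c / d)
    (hqd : 10 * (d : ℝ) ≤ (3 / 2) ^ q) :
    (selectionLaw U c).real {ω | ¬ ∀ z : Fin d → ℝ, 1 / 4 * (z ⬝ᵥ z) ≤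
      ∑ i, samplingWeight U c ω i * (U i ⬝ᵥ z) ^ 2} ≤ 1 / 10 := by
  have : IsProbabilityMeasure (selectionLaw U c) := by unfold selectionLaw; infer_instance
  have hw : ∀ ω i, 0 ≤ samplingWeight U c ω i := fun ω i => by
    unfold samplingWeight
    split_ifs
    exacts [inv_nonneg.2 (samplingProb U c i).2.1, le_rfl]
  have hM := measureReal_lt_le_of_integral_le (selectionLaw U c)
    (F := fun ω => ((shiftedGram U (samplingWeight U c ω))⁻¹ ^ q).trace)
    (fun ω => trace_inv_pow_nonneg (shiftedGram_isHermitian _ _) (by norm_num)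
      (le_dotProduct_shiftedGram_mulVec U (hw ω)) q) (t := 10) (by norm_num)
    (integral_trace_inv_pow_le hU hd hc hq)
  refine (measureReal_mono ?_).trans (hM.trans (by norm_num))
  intro ω hω
  by_contra hcon
  refine hω fun z => ?_
  -- Since 2 = (3/2)(4/3), the factor (3/2)^q absorbs 10d. All eigenvalues are then at least 1/2,
  -- and removing the shift leaves 1/4.
  have h1 : ((shiftedGram U (samplingWeight U c ω))⁻¹ ^ q).trace ≤ (1 / 2 : ℝ)⁻¹ ^ q := by
    refine (not_lt.1 hcon).trans ?_
    have e : (1 / 2 : ℝ)⁻¹ ^ q = (3 / 2) ^ q * (4 / 3) ^ q := by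
      rw [← mul_pow]; norm_num
    rw [e, ← mul_assoc]
    exact mul_le_mul_of_nonneg_right hqd (by positivity)
  have h2 := le_of_trace_inv_pow_le (shiftedGram_isHermitian _ _) (by norm_num)
      (le_dotProduct_shiftedGram_mulVec U (hw ω)) (by norm_num) hq0 h1 z
  rw [dotProduct_shiftedGram_mulVec] at h2
  linarith

/-- Approximate matrix multiplication: a vector orthogonal to the columns of `W` stays nearly
orthogonal after sampling. -/
lemma measureReal_sum_sq_le {U W : Matrix (Fin n) (Fin d) ℝ} (hW : ∀ i j, W i j ^ 2 ≤ U i j ^ 2)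
    {r : Fin n → ℝ} (hr : ∀ j, ∑ i, r i * W i j = 0) {c : ℕ} (hd : 0 < d) (hc : 0 < c) :
    (selectionLaw U c).real {ω | ¬ ∑ j, (∑ i, samplingWeight U c ω i * (r i * W i j)) ^ 2 ≤
      10 * (d / c * ∑ i, r i ^ 2)} ≤ 1 / 10 := by
  classical
  have : IsProbabilityMeasure (selectionLaw U c) := by unfold selectionLaw; infer_instance
  have hd' : (0 : ℝ) < d := Nat.cast_pos.2 hd
  have hc' : (0 : ℝ) < c := Nat.cast_pos.2 hc
  set p := samplingProb U c with hp
  have hp0 : ∀ i, 0 ≤ (p i : ℝ) := fun i => (p i).2.1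
  have hint : ∫ ω, ∑ j, (∑ i, samplingWeight U c ω i * (r i * W i j)) ^ 2 ∂(selectionLaw U c) ≤
      d / c * ∑ i, r i ^ 2 := by
    -- With all weights equal to their mean 1 the sum vanishes by `hr`; the errors e are bounds for
    -- the variances of the single terms.
    have step := integral_pi_bernoulli_le p (y := fun i => (p i : ℝ)⁻¹) (a := fun _ => 1)
      (e := fun i => d / c * r i ^ 2)
      (fun i => inv_nonneg.2 (hp0 i)) (fun i => zero_le_one)
      (fun x => ∑ j, (∑ i, x i * (r i * W i j)) ^ 2) (by
        intro i x _
        have key : ∀ (t : ℝ) j, ∑ k, Function.update x i t k * (r k * W k j) =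
            t * (r i * W i j) + ∑ k ∈ Finset.univ.erase i, x k * (r k * W k j) := by
          intro t j
          rw [← Finset.add_sum_erase _ _ (Finset.mem_univ i), Function.update_self]
          congr 1
          exact Finset.sum_congr rfl fun k hk => by
            rw [Function.update_of_ne (Finset.ne_of_mem_erase hk)]
        simp only [key]
        have hl : ∑ j, W i j ^ 2 ≤ U i ⬝ᵥ U i := by
          rw [dotProduct]
          exact Finset.sum_le_sum fun j _ => (hW i j).trans_eq (pow_two _)
        have hl0 : 0 ≤ ∑ j, W i j ^ 2 := Finset.sum_nonneg fun j _ => sq_nonneg _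
        have hpi := coe_samplingProb U c i
        rw [← hp] at hpi
        rcases (hp0 i).eq_or_lt with h0 | h0
        · have h1 : U i ⬝ᵥ U i ≤ 0 := by
            by_contra hneg
            have : 0 < min 1 ((c : ℝ) / d * (U i ⬝ᵥ U i)) :=
              lt_min zero_lt_one (mul_pos (by positivity) (not_le.1 hneg))
            rw [← hpi, ← h0] at this
            exact this.false
          have h2 : ∀ j, W i j = 0 := by
            have h3 : ∑ j, W i j ^ 2 = 0 := le_antisymm (hl.trans h1) hl0
            intro j
            exact pow_eq_zero_iff two_ne_zero |>.1
              ((Finset.sum_eq_zero_iff_of_nonneg fun j _ => sq_nonneg _).1 h3 j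
                (Finset.mem_univ j))
          simp only [h2, mul_zero, zero_add, ← h0]
          have : 0 ≤ d / c * r i ^ 2 := by positivity
          linarith
        -- Bias-variance identity: the weight has mean 1 and variance 1/p − 1.
        · have e : ∀ s m : ℝ, (p i : ℝ) * ((p i : ℝ)⁻¹ * m + s) ^ 2 + (1 - p i) * (0 * m + s) ^ 2 =
              (1 * m + s) ^ 2 + ((p i : ℝ)⁻¹ - 1) * m ^ 2 := by
            intro s m; field_simp; ring
          rw [Finset.mul_sum, Finset.mul_sum, ← Finset.sum_add_distrib]
          simp only [e]
          rw [Finset.sum_add_distrib, ← Finset.mul_sum]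
          simp only [mul_pow, ← Finset.mul_sum]
          have : ((p i : ℝ)⁻¹ - 1) * ∑ j, W i j ^ 2 ≤ d / c := by
            rcases min_choice 1 ((c : ℝ) / d * (U i ⬝ᵥ U i)) with h2 | h2
            · rw [hpi, h2]; simp; positivity
            · rw [h2] at hpi
              have hl1 : 0 < U i ⬝ᵥ U i := by
                rw [hpi] at h0
                exact pos_of_mul_pos_right h0 (by positivity)
              calc ((p i : ℝ)⁻¹ - 1) * ∑ j, W i j ^ 2 ≤ (p i : ℝ)⁻¹ * ∑ j, W i j ^ 2 :=
                    mul_le_mul_of_nonneg_right (by linarith) hl0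
                _ ≤ (p i : ℝ)⁻¹ * (U i ⬝ᵥ U i) :=
                    mul_le_mul_of_nonneg_left hl (inv_nonneg.2 h0.le)
                _ = d / c := by rw [hpi]; field_simp
          nlinarith [mul_le_mul_of_nonneg_left this (sq_nonneg (r i))])
    simp only [one_mul, hr] at step
    have h0 : ∑ _j : Fin d, (0 : ℝ) ^ 2 = 0 := by simp
    rw [← Finset.mul_sum, h0, zero_add] at step
    exact step
  have hM := measureReal_lt_le_of_integral_le (selectionLaw U c)
    (F := fun ω => ∑ j, (∑ i, samplingWeight U c ω i * (r i * W i j)) ^ 2)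
    (fun ω => Finset.sum_nonneg fun j _ => sq_nonneg _) (t := 10) (by norm_num) hint
  simp only [not_le]
  exact hM.trans (by norm_num)

end Sampling

/-! ### Normal equations and deterministic error analysis -/

section LeastSquares

variable {n d : ℕ}

/-- The normal equations of a least squares problem. -/
lemma IsLeastSquaresSolution.inner_eq_zero {m : Type*} [Fintype m] {A : Matrix m (Fin d) ℝ}
    {b : EuclideanSpace ℝ m} {β : EuclideanSpace ℝ (Fin d)} (h : IsLeastSquaresSolution A b β)
    (δ : EuclideanSpace ℝ (Fin d)) :
    inner ℝ (A.toEuclideanLin δ) (b - A.toEuclideanLin β) = 0 := by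
  set a := inner ℝ (A.toEuclideanLin δ) (b - A.toEuclideanLin β) with ha
  have key : ∀ t : ℝ, 2 * t * a ≤ t ^ 2 * ‖A.toEuclideanLin δ‖ ^ 2 := by
    intro t
    have h1 : ‖b - A.toEuclideanLin β‖ ^ 2 ≤ ‖b - A.toEuclideanLin (β + t • δ)‖ ^ 2 :=
      h (Set.mem_univ _)
    have h2 : b - A.toEuclideanLin (β + t • δ) =
        (b - A.toEuclideanLin β) - t • A.toEuclideanLin δ := by
      rw [map_add, map_smul]; abel
    rw [h2, norm_sub_sq_real (b - _), inner_smul_right, real_inner_comm, ← ha, norm_smul, mul_pow,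
      Real.norm_eq_abs, sq_abs] at h1
    linarith
  set N := ‖A.toEuclideanLin δ‖ ^ 2 with hN
  have hN0 : 0 ≤ N := by positivity
  -- The optimal t would be a/N; adding 1 avoids the case N = 0.
  have h3 := key (a / (N + 1))
  have e1 : 2 * (a / (N + 1)) * a = 2 * (N + 1) * a ^ 2 / (N + 1) ^ 2 := by
    field_simp
  have e2 : (a / (N + 1)) ^ 2 * N = N * a ^ 2 / (N + 1) ^ 2 := by
    field_simp
  rw [e1, e2, div_le_div_iff_of_pos_right (by positivity)] at h3
  have h4 : a ^ 2 ≤ 0 := by nlinarith [sq_nonneg a, mul_nonneg hN0 (sq_nonneg a)]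
  exact pow_eq_zero_iff two_ne_zero |>.1 (le_antisymm h4 (sq_nonneg a))

lemma toEuclideanLin_apply_apply {m : Type*} [Fintype m] (A : Matrix m (Fin d) ℝ)
    (β : EuclideanSpace ℝ (Fin d)) (i : m) : A.toEuclideanLin β i = (A *ᵥ β.ofLp) i := by
  simp [toLpLin_apply]

lemma samplingMatrix_mulVec (U : Matrix (Fin n) (Fin d) ℝ) (c : ℕ) (ω : Fin n → Bool)
    (v : Fin n → ℝ) (i : {i : Fin n // ω i = true}) :
    (samplingMatrix U c ω *ᵥ v) i = (Real.sqrt (samplingProb U c i))⁻¹ * v i := by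
  have : (samplingMatrix U c ω *ᵥ v) i =
      ((diagonal fun i => (Real.sqrt (samplingProb U c i))⁻¹) *ᵥ v) i := rfl
  rw [this, mulVec_diagonal]

/-- The normal equations of the sampled problem. -/
lemma IsLeastSquaresSolution.sum_samplingWeight_eq_zero {X U : Matrix (Fin n) (Fin d) ℝ} {c : ℕ}
    {ω : Fin n → Bool} {y : EuclideanSpace ℝ (Fin n)} {β : EuclideanSpace ℝ (Fin d)}
    (h : IsLeastSquaresSolution (samplingMatrix U c ω * X)
      ((samplingMatrix U c ω).toEuclideanLin y) β) (δ : Fin d → ℝ) :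
    ∑ i, samplingWeight U c ω i * ((X *ᵥ δ) i * (y i - (X *ᵥ β.ofLp) i)) = 0 := by
  have h1 := h.inner_eq_zero (WithLp.toLp 2 δ)
  rw [PiLp.inner_apply] at h1
  have h2 : ∀ i : {i : Fin n // ω i = true}, inner ℝ
      ((samplingMatrix U c ω * X).toEuclideanLin (WithLp.toLp 2 δ) i)
      (((samplingMatrix U c ω).toEuclideanLin y -
        (samplingMatrix U c ω * X).toEuclideanLin β) i) =
      samplingWeight U c ω i * ((X *ᵥ δ) i * (y i - (X *ᵥ β.ofLp) i)) := by
    intro i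
    have e : (samplingMatrix U c ω).toEuclideanLin y i =
        (Real.sqrt (samplingProb U c i))⁻¹ * y i := by
      rw [toLpLin_apply]
      exact samplingMatrix_mulVec U c ω y.ofLp i
    rw [PiLp.sub_apply, e, toEuclideanLin_apply_apply, toEuclideanLin_apply_apply, ← mulVec_mulVec,
      ← mulVec_mulVec, samplingMatrix_mulVec, samplingMatrix_mulVec]
    have hs : (samplingProb U c i : ℝ)⁻¹ = (Real.sqrt (samplingProb U c i))⁻¹ *
        (Real.sqrt (samplingProb U c i))⁻¹ := by
      rw [← mul_inv, Real.mul_self_sqrt (samplingProb U c i).2.1]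
    simp only [samplingWeight, i.2, if_true, hs, Real.inner_apply]
    ring
  rw [Finset.sum_congr rfl fun i _ => h2 i] at h1
  rw [← h1, ← Finset.sum_subtype (Finset.univ.filter fun i => ω i = true) (by simp)
    (fun i => samplingWeight U c ω i * ((X *ᵥ δ) i * (y i - (X *ᵥ β.ofLp) i)))]
  refine (Finset.sum_filter_of_ne fun i _ hi => ?_).symm
  by_contra hω
  exact hi (by simp [samplingWeight, hω])

lemma norm_sub_toEuclideanLin_sq (X : Matrix (Fin n) (Fin d) ℝ) (y : EuclideanSpace ℝ (Fin n))
    (β : EuclideanSpace ℝ (Fin d)) :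
    ‖y - X.toEuclideanLin β‖ ^ 2 = ∑ i, (y i - (X *ᵥ β.ofLp) i) ^ 2 := by
  rw [EuclideanSpace.real_norm_sq_eq]
  simp only [PiLp.sub_apply, toEuclideanLin_apply_apply]

/-- The normal equations of the full problem. -/
lemma IsLeastSquaresSolution.sum_mul_eq_zero {X : Matrix (Fin n) (Fin d) ℝ}
    {y : EuclideanSpace ℝ (Fin n)} {β : EuclideanSpace ℝ (Fin d)}
    (h : IsLeastSquaresSolution X y β) (δ : Fin d → ℝ) :
    ∑ i, (y i - (X *ᵥ β.ofLp) i) * (X *ᵥ δ) i = 0 := by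
  have h1 := h.inner_eq_zero (WithLp.toLp 2 δ)
  rw [PiLp.inner_apply] at h1
  rw [← h1]
  refine Finset.sum_congr rfl fun i _ => ?_
  rw [PiLp.sub_apply, toEuclideanLin_apply_apply, toEuclideanLin_apply_apply, Real.inner_apply,
    mul_comm]

section ThinSVD

variable {X U : Matrix (Fin n) (Fin d) ℝ} {V : Matrix (Fin d) (Fin d) ℝ}

lemma singularValue_nonneg (X : Matrix (Fin n) (Fin d) ℝ) (i : ℕ) : 0 ≤ singularValue X i :=
  LinearMap.singularValues_nonneg _ _

lemma sigmaMin_le_singularValue (X : Matrix (Fin n) (Fin d) ℝ) (j : Fin d) :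
    sigmaMin X ≤ singularValue X j :=
  LinearMap.singularValues_antitone _ (Nat.le_sub_one_of_lt j.2)

lemma singularValue_le_sigmaMax (X : Matrix (Fin n) (Fin d) ℝ) (j : ℕ) :
    singularValue X j ≤ sigmaMax X :=
  LinearMap.singularValues_antitone _ (Nat.zero_le j)

/-- The coordinates `Σ Vᵀ δ` of `X δ` in the basis of left singular vectors. -/
def leftCoords (X : Matrix (Fin n) (Fin d) ℝ) (V : Matrix (Fin d) (Fin d) ℝ) (δ : Fin d → ℝ) :
    Fin d → ℝ :=
  fun j => singularValue X j * (Vᵀ *ᵥ δ) j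

lemma IsThinSVD.mulVec_eq (h : IsThinSVD X U V) (δ : Fin d → ℝ) :
    X *ᵥ δ = U *ᵥ leftCoords X V δ := by
  conv_lhs => rw [h.eq_mul]
  rw [← mulVec_mulVec, ← mulVec_mulVec]
  congr 1
  ext j
  rw [mulVec_diagonal, leftCoords]

lemma IsThinSVD.sum_sq_mulVec (h : IsThinSVD X U V) (δ : Fin d → ℝ) :
    ∑ i, (X *ᵥ δ) i ^ 2 = leftCoords X V δ ⬝ᵥ leftCoords X V δ := by
  rw [h.mulVec_eq, ← sum_sq_dotProduct_row h.left_orthonormal]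
  rfl

lemma IsThinSVD.sum_sq_transpose_mulVec (h : IsThinSVD X U V) (δ : Fin d → ℝ) :
    ∑ j, (Vᵀ *ᵥ δ) j ^ 2 = δ ⬝ᵥ δ :=
  LeverageLSR.sum_sq_transpose_mulVec (mul_eq_one_comm.mp h.right_orthonormal) δ

lemma IsThinSVD.sigmaMin_sq_mul_le (h : IsThinSVD X U V) (h0 : 0 ≤ sigmaMin X) (δ : Fin d → ℝ) :
    sigmaMin X ^ 2 * (δ ⬝ᵥ δ) ≤ leftCoords X V δ ⬝ᵥ leftCoords X V δ := by
  rw [← h.sum_sq_transpose_mulVec, Finset.mul_sum, dotProduct]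
  refine Finset.sum_le_sum fun j _ => ?_
  rw [leftCoords, ← pow_two, mul_pow]
  exact mul_le_mul_of_nonneg_right (pow_le_pow_left₀ h0 (sigmaMin_le_singularValue X j) 2)
    (sq_nonneg _)

lemma IsThinSVD.le_sigmaMax_sq_mul (h : IsThinSVD X U V) (δ : Fin d → ℝ) :
    leftCoords X V δ ⬝ᵥ leftCoords X V δ ≤ sigmaMax X ^ 2 * (δ ⬝ᵥ δ) := by
  rw [← h.sum_sq_transpose_mulVec δ, Finset.mul_sum, dotProduct]
  refine Finset.sum_le_sum fun j _ => ?_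
  rw [leftCoords, ← pow_two, mul_pow]
  exact mul_le_mul_of_nonneg_right
    (pow_le_pow_left₀ (singularValue_nonneg X j) (singularValue_le_sigmaMax X j) 2) (sq_nonneg _)

/-- A vector orthogonal to the range of `X` is orthogonal to the left singular vectors with
nonzero singular value. -/
lemma IsThinSVD.sum_mul_left_eq_zero (h : IsThinSVD X U V) {r : Fin n → ℝ}
    (hr : ∀ δ, ∑ i, r i * (X *ᵥ δ) i = 0) {j : Fin d} (hj : singularValue X j ≠ 0) :
    ∑ i, r i * U i j = 0 := by
  have h1 := hr (V *ᵥ Pi.single j 1)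
  have h2 : leftCoords X V (V *ᵥ Pi.single j 1) = Pi.single j (singularValue X j) := by
    ext k
    rw [leftCoords, mulVec_mulVec, h.right_orthonormal, one_mulVec]
    by_cases hk : k = j
    · subst hk; simp
    · simp [hk]
  rw [h.mulVec_eq, h2] at h1
  simp only [mulVec_single, Pi.smul_apply, col_apply, MulOpposite.smul_eq_mul_unop,
    MulOpposite.unop_op, ← mul_assoc, ← Finset.sum_mul] at h1
  exact (mul_eq_zero.1 h1).resolve_right hj

/-- The left singular vectors spanning the range of `X`, the others being replaced by `0`. -/
def rangeLeft (X U : Matrix (Fin n) (Fin d) ℝ) : Matrix (Fin n) (Fin d) ℝ :=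
  of fun i j => if singularValue X j = 0 then 0 else U i j

lemma rangeLeft_sq_le (X U : Matrix (Fin n) (Fin d) ℝ) (i : Fin n) (j : Fin d) :
    rangeLeft X U i j ^ 2 ≤ U i j ^ 2 := by
  simp only [rangeLeft, of_apply]
  split_ifs
  · simpa using sq_nonneg (U i j)
  · exact le_rfl

/-- If X is rank deficient, r need not be orthogonal to the columns of U of zero singular value, as
they can leave the range of X; zeroing them restores orthogonality. -/
lemma IsThinSVD.sum_mul_rangeLeft_eq_zero (h : IsThinSVD X U V) {r : Fin n → ℝ}
    (hr : ∀ δ, ∑ i, r i * (X *ᵥ δ) i = 0) (j : Fin d) : ∑ i, r i * rangeLeft X U i j = 0 := by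
  by_cases hj : singularValue X j = 0
  · simp [rangeLeft, hj]
  · simpa [rangeLeft, hj] using h.sum_mul_left_eq_zero hr hj

/-- The coordinates carry the factor σⱼ, so they vanish on exactly the columns that were zeroed. -/
lemma mulVec_leftCoords_eq (X U : Matrix (Fin n) (Fin d) ℝ) (V : Matrix (Fin d) (Fin d) ℝ)
    (δ : Fin d → ℝ) : U *ᵥ leftCoords X V δ = rangeLeft X U *ᵥ leftCoords X V δ := by
  ext i
  simp only [mulVec, dotProduct]
  refine Finset.sum_congr rfl fun j _ => ?_
  by_cases hj : singularValue X j = 0 <;> simp [rangeLeft, leftCoords, hj]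

/-- A subspace embedding with approximate orthogonality of the residual controls the error of the
sampled solution in the coordinates of the left singular vectors. -/
lemma IsThinSVD.leftCoords_sub_le (h : IsThinSVD X U V) {y : EuclideanSpace ℝ (Fin n)}
    {β β' : EuclideanSpace ℝ (Fin d)} {c : ℕ} {ω : Fin n → Bool}
    (hβ' : IsLeastSquaresSolution (samplingMatrix U c ω * X)
      ((samplingMatrix U c ω).toEuclideanLin y) β')
    (hemb : ∀ z : Fin d → ℝ, 1 / 4 * (z ⬝ᵥ z) ≤
      ∑ i, samplingWeight U c ω i * (U i ⬝ᵥ z) ^ 2) :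
    leftCoords X V (β'.ofLp - β.ofLp) ⬝ᵥ leftCoords X V (β'.ofLp - β.ofLp) ≤
      16 * ∑ j, (∑ i, samplingWeight U c ω i *
        ((y i - (X *ᵥ β.ofLp) i) * rangeLeft X U i j)) ^ 2 := by
  set z := leftCoords X V (β'.ofLp - β.ofLp) with hz
  set g : Fin d → ℝ := fun j => ∑ i, samplingWeight U c ω i *
    ((y i - (X *ᵥ β.ofLp) i) * rangeLeft X U i j) with hg
  have h1 := hβ'.sum_samplingWeight_eq_zero (β'.ofLp - β.ofLp)
  have hX : ∀ i, (X *ᵥ β'.ofLp) i = (X *ᵥ β.ofLp) i + U i ⬝ᵥ z := by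
    intro i
    have e : β'.ofLp = β.ofLp + (β'.ofLp - β.ofLp) := by abel
    have e2 : (X *ᵥ (β'.ofLp - β.ofLp)) i = U i ⬝ᵥ z := by rw [h.mulVec_eq]; rfl
    rw [← e2, e, mulVec_add, Pi.add_apply, ← e]
  have hXδ : ∀ i, (X *ᵥ (β'.ofLp - β.ofLp)) i = U i ⬝ᵥ z := fun i => by rw [h.mulVec_eq]; rfl
  have hUW : ∀ i, U i ⬝ᵥ z = rangeLeft X U i ⬝ᵥ z := fun i =>
    congrFun (mulVec_leftCoords_eq X U V (β'.ofLp - β.ofLp)) i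
  -- The sampled residual is r − Uz; this is its weighted orthogonality to Uz.
  have h2 : ∑ i, samplingWeight U c ω i * (U i ⬝ᵥ z) ^ 2 = ∑ j, z j * g j := by
    have e1 : ∑ j, z j * g j = ∑ i, samplingWeight U c ω i *
        ((y i - (X *ᵥ β.ofLp) i) * (U i ⬝ᵥ z)) := by
      simp only [hg, hUW]
      simp only [dotProduct, Finset.mul_sum]
      rw [Finset.sum_comm]
      refine Finset.sum_congr rfl fun i _ => Finset.sum_congr rfl fun j _ => ?_
      ring
    rw [e1, ← sub_eq_zero, ← neg_eq_zero, ← h1, ← Finset.sum_sub_distrib, ← Finset.sum_neg_distrib]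
    refine Finset.sum_congr rfl fun i _ => ?_
    rw [hX, hXδ]
    ring
  have h3 := hemb z
  rw [h2] at h3
  -- Young's inequality; absorbing |z|²/8 into |z|²/4 gives the factor 16.
  have h4 : ∑ j, z j * g j ≤ 1 / 8 * (z ⬝ᵥ z) + 2 * ∑ j, g j ^ 2 := by
    rw [dotProduct, Finset.mul_sum, Finset.mul_sum, ← Finset.sum_add_distrib]
    refine Finset.sum_le_sum fun j _ => ?_
    nlinarith [sq_nonneg (z j - 4 * g j)]
  linarith

/-- The residual is small relative to the solution when much of `y` lies in the range of `X`. -/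
lemma IsThinSVD.residual_le (h : IsThinSVD X U V) {y : EuclideanSpace ℝ (Fin n)}
    {β : EuclideanSpace ℝ (Fin d)} (hβ : IsLeastSquaresSolution X y β) (hσ : 0 < sigmaMin X)
    {γ : ℝ} (hγ : 0 < γ) (hy : γ * ‖y‖ ≤ ‖(U * U.transpose).toEuclideanLin y‖) :
    ‖y - X.toEuclideanLin β‖ ^ 2 ≤ sigmaMax X ^ 2 * ((γ ^ 2)⁻¹ - 1) * ‖β‖ ^ 2 := by
  have horth := hβ.sum_mul_eq_zero
  have hUr : ∀ j, ∑ i, (y i - (X *ᵥ β.ofLp) i) * U i j = 0 := fun j =>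
    h.sum_mul_left_eq_zero horth (hσ.trans_le (sigmaMin_le_singularValue X j)).ne'
  have hUy : Uᵀ *ᵥ y.ofLp = leftCoords X V β.ofLp := by
    have e : Uᵀ *ᵥ (X *ᵥ β.ofLp) = leftCoords X V β.ofLp := by
      rw [h.mulVec_eq, mulVec_mulVec, h.left_orthonormal, one_mulVec]
    rw [← e]
    ext j
    have := hUr j
    simp only [sub_mul, Finset.sum_sub_distrib, sub_eq_zero] at this
    simpa [mulVec, dotProduct, mul_comm] using this
  have hproj : ‖(U * U.transpose).toEuclideanLin y‖ ^ 2 = ∑ i, (X *ᵥ β.ofLp) i ^ 2 := by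
    rw [EuclideanSpace.real_norm_sq_eq]
    refine Finset.sum_congr rfl fun i _ => ?_
    rw [toEuclideanLin_apply_apply, ← mulVec_mulVec, hUy, ← h.mulVec_eq]
  set P := ∑ i, (X *ᵥ β.ofLp) i ^ 2 with hP
  set R := ‖y - X.toEuclideanLin β‖ ^ 2 with hR
  have hR0 : 0 ≤ R := by positivity
  have hnorm : ‖y‖ ^ 2 = R + P := by
    rw [hR, norm_sub_toEuclideanLin_sq, EuclideanSpace.real_norm_sq_eq, hP]
    have e : ∑ i, y i ^ 2 = ∑ i, (y i - (X *ᵥ β.ofLp) i) ^ 2 + ∑ i, (X *ᵥ β.ofLp) i ^ 2 +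
        2 * ∑ i, (y i - (X *ᵥ β.ofLp) i) * (X *ᵥ β.ofLp) i := by
      rw [Finset.mul_sum, ← Finset.sum_add_distrib, ← Finset.sum_add_distrib]
      exact Finset.sum_congr rfl fun i _ => by ring
    rw [e, horth β.ofLp, mul_zero, add_zero]
  have hγP : γ ^ 2 * (R + P) ≤ P := by
    rw [← hnorm, ← mul_pow, ← hproj]
    exact pow_le_pow_left₀ (by positivity) hy 2
  have hβn : ‖β‖ ^ 2 = β.ofLp ⬝ᵥ β.ofLp := by
    rw [EuclideanSpace.real_norm_sq_eq]; simp [dotProduct, pow_two]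
  have hPmax : P ≤ sigmaMax X ^ 2 * ‖β‖ ^ 2 := by
    rw [hβn, hP, h.sum_sq_mulVec]; exact h.le_sigmaMax_sq_mul _
  have hPmin : sigmaMin X ^ 2 * ‖β‖ ^ 2 ≤ P := by
    rw [hβn, hP, h.sum_sq_mulVec]; exact h.sigmaMin_sq_mul_le hσ.le _
  have hRP : R ≤ ((γ ^ 2)⁻¹ - 1) * P := by
    have : R + P ≤ (γ ^ 2)⁻¹ * P := by
      rw [inv_mul_eq_div, le_div_iff₀ (by positivity)]; linarith
    linarith
  rcases le_or_gt 0 ((γ ^ 2)⁻¹ - 1) with h1 | h1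
  · calc R ≤ ((γ ^ 2)⁻¹ - 1) * P := hRP
      _ ≤ ((γ ^ 2)⁻¹ - 1) * (sigmaMax X ^ 2 * ‖β‖ ^ 2) := mul_le_mul_of_nonneg_left hPmax h1
      _ = _ := by ring
  -- Here γ > 1, which forces Xβ = 0 and, as σ_min > 0, β = 0.
  · have hP0 : 0 ≤ P := Finset.sum_nonneg fun i _ => sq_nonneg _
    have hPz : P = 0 := by
      by_contra hne
      have := mul_neg_of_neg_of_pos h1 (lt_of_le_of_ne hP0 (Ne.symm hne))
      linarith
    rw [hPz] at hPmin hRP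
    have hb : ‖β‖ ^ 2 = 0 := by
      refine le_antisymm ?_ (sq_nonneg _)
      by_contra hpos
      have := mul_pos (pow_pos hσ 2) (not_le.1 hpos)
      linarith
    rw [hb]
    linarith

end ThinSVD

end LeastSquares

/-! ### Choice of the exponent and assembly -/

section SampleSize

/-- The number of samples allows an exponent which makes the dimension factor harmless. -/
lemma exists_exponent {d : ℕ} (hd : 0 < d) {ε K : ℝ} (hε : 0 < ε) (h : 2 ≤ d ∨ ε ≤ 1)
    (hK : 200 * (Real.log d + 1 / ε) ≤ K) :
    ∃ q : ℕ, q ≠ 0 ∧ 8 * (q : ℝ) ≤ K ∧ 10 * (d : ℝ) ≤ (3 / 2) ^ q := by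
  have hd1 : (1 : ℝ) ≤ d := Nat.one_le_cast.2 hd
  have hlog : 0 ≤ Real.log d := Real.log_nonneg hd1
  have hq : 3 * Real.log d + 9 ≤ (⌈3 * Real.log d + 9⌉₊ : ℝ) := Nat.le_ceil _
  have hq' : (⌈3 * Real.log d + 9⌉₊ : ℝ) < 3 * Real.log d + 9 + 1 :=
    Nat.ceil_lt_add_one (by positivity)
  -- As log(3/2) ≥ 1/3, this gives (3/2)^q ≥ e³d ≥ 10d.
  refine ⟨⌈3 * Real.log d + 9⌉₊, (Nat.ceil_pos.2 (by positivity)).ne', ?_, ?_⟩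
  · have hinv : 0 < 1 / ε := by positivity
    -- This is 8(3 log d + 10) ≤ 200(log d + 1/ε) rearranged. The alternative d ≥ 2 or ε ≤ 1 keeps
    -- the right side away from 0.
    have : 80 ≤ 176 * Real.log d + 200 * (1 / ε) := by
      rcases h with h | h
      · have h2 : Real.log 2 ≤ Real.log d := Real.log_le_log (by norm_num) (by exact_mod_cast h)
        have := Real.log_two_gt_d9
        linarith
      · have : 1 ≤ 1 / ε := by rw [le_div_iff₀ hε]; linarith
        linarith
    linarith
  · set q := ⌈3 * Real.log d + 9⌉₊
    have h32 : 1 / 3 ≤ Real.log (3 / 2) := by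
      have := Real.one_sub_inv_le_log_of_pos (x := 3 / 2) (by norm_num)
      norm_num at this ⊢
      linarith
    have h10 : (10 : ℝ) ≤ Real.exp 3 := by
      have h1 := Real.exp_one_gt_d9
      have h2 : Real.exp 3 = Real.exp 1 ^ 3 := by rw [← Real.exp_nat_mul]; norm_num
      rw [h2]
      have : (2.5 : ℝ) ^ 3 ≤ Real.exp 1 ^ 3 := pow_le_pow_left₀ (by norm_num) (by linarith) 3
      norm_num at this ⊢
      linarith
    calc 10 * (d : ℝ) ≤ Real.exp 3 * d := mul_le_mul_of_nonneg_right h10 (by linarith)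
      _ = Real.exp (3 + Real.log d) := by rw [Real.exp_add, Real.exp_log (by linarith)]
      _ ≤ Real.exp (Real.log (3 / 2) * q) := by
          refine Real.exp_le_exp.2 ?_
          nlinarith
      _ = (3 / 2) ^ q := by
          rw [← Real.rpow_def_of_pos (by norm_num), Real.rpow_natCast]

end SampleSize

/-- The union bound for the complement of two rare events. -/
lemma one_sub_le_measureReal_of_union {Ω : Type*} [Finite Ω] [MeasurableSpace Ω]
    [DiscreteMeasurableSpace Ω] {μ : Measure Ω} [IsProbabilityMeasure μ] {P Q T : Ω → Prop}
    {a b : ℝ} (hP : μ.real {ω | P ω} ≤ a) (hQ : μ.real {ω | Q ω} ≤ b)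
    (hT : ∀ ω, ¬ P ω → ¬ Q ω → T ω) : 1 - (a + b) ≤ μ.real {ω | T ω} := by
  have h1 : 1 - μ.real ({ω | P ω} ∪ {ω | Q ω}) ≤ μ.real {ω | T ω} := by
    rw [← probReal_compl_eq_one_sub (Set.toFinite _).measurableSet]
    exact measureReal_mono fun ω hω => hT ω (fun h => hω (Or.inl h)) fun h => hω (Or.inr h)
  have h2 := measureReal_union_le (μ := μ) {ω | P ω} {ω | Q ω}
  linarith

/-- Deterministic consequences of a small error in the coordinates of the left singular vectors. -/
lemma IsThinSVD.error_bounds {n d : ℕ} {X U : Matrix (Fin n) (Fin d) ℝ}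
    {V : Matrix (Fin d) (Fin d) ℝ} (h : IsThinSVD X U V) {y : EuclideanSpace ℝ (Fin n)}
    {β β' : EuclideanSpace ℝ (Fin d)} (hβ : IsLeastSquaresSolution X y β) {ε : ℝ} (hε : 0 < ε)
    (hz : leftCoords X V (β'.ofLp - β.ofLp) ⬝ᵥ leftCoords X V (β'.ofLp - β.ofLp) ≤
      ε * ‖y - X.toEuclideanLin β‖ ^ 2) :
    ‖y - X.toEuclideanLin β'‖ ^ 2 ≤ (1 + ε) * ‖y - X.toEuclideanLin β‖ ^ 2 ∧
      (0 < sigmaMin X →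
        ‖β - β'‖ ^ 2 ≤ ε / sigmaMin X ^ 2 * ‖y - X.toEuclideanLin β‖ ^ 2 ∧
        ∀ γ : ℝ, 0 < γ → γ * ‖y‖ ≤ ‖(U * U.transpose).toEuclideanLin y‖ →
          ε / sigmaMin X ^ 2 * ‖y - X.toEuclideanLin β‖ ^ 2 ≤
            ε * condNumber X ^ 2 * ((γ ^ 2)⁻¹ - 1) * ‖β‖ ^ 2) := by
  refine ⟨?_, fun hσ => ⟨?_, fun γ hγ hy => ?_⟩⟩
  · have hX : X *ᵥ β'.ofLp = X *ᵥ β.ofLp + X *ᵥ (β'.ofLp - β.ofLp) := by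
      rw [← mulVec_add]; congr 1; abel
    have e : ‖y - X.toEuclideanLin β'‖ ^ 2 = ‖y - X.toEuclideanLin β‖ ^ 2 +
        leftCoords X V (β'.ofLp - β.ofLp) ⬝ᵥ leftCoords X V (β'.ofLp - β.ofLp) -
        2 * ∑ i, (y i - (X *ᵥ β.ofLp) i) * (X *ᵥ (β'.ofLp - β.ofLp)) i := by
      rw [norm_sub_toEuclideanLin_sq, norm_sub_toEuclideanLin_sq, ← h.sum_sq_mulVec, hX,
        Finset.mul_sum, ← Finset.sum_add_distrib, ← Finset.sum_sub_distrib]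
      refine Finset.sum_congr rfl fun i _ => ?_
      rw [Pi.add_apply]
      ring
    rw [hβ.sum_mul_eq_zero] at e
    linarith
  · have e : ‖β - β'‖ ^ 2 = (β'.ofLp - β.ofLp) ⬝ᵥ (β'.ofLp - β.ofLp) := by
      rw [norm_sub_rev, EuclideanSpace.real_norm_sq_eq]
      simp [dotProduct, pow_two]
    rw [e, div_mul_eq_mul_div, le_div_iff₀ (by positivity), mul_comm]
    exact (h.sigmaMin_sq_mul_le hσ.le _).trans hz
  · have e : ε * condNumber X ^ 2 * ((γ ^ 2)⁻¹ - 1) * ‖β‖ ^ 2 =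
        ε / sigmaMin X ^ 2 * (sigmaMax X ^ 2 * ((γ ^ 2)⁻¹ - 1) * ‖β‖ ^ 2) := by
      rw [condNumber, div_pow]; ring
    rw [e]
    exact mul_le_mul_of_nonneg_left (h.residual_le hβ hσ hγ hy) (by positivity)

end LeverageLSR

end

open LeverageLSR in
theorem theorem1 :
    ∃ C : ℝ, 0 < C ∧
      ∀ (n d : ℕ) (X U : Matrix (Fin n) (Fin d) ℝ) (V : Matrix (Fin d) (Fin d) ℝ)
        (y : EuclideanSpace ℝ (Fin n)) (β : EuclideanSpace ℝ (Fin d)) (ε : ℝ) (c : ℕ),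
        0 < d → IsThinSVD X U V → IsLeastSquaresSolution X y β →
        0 < ε → (2 ≤ d ∨ ε ≤ 1) →
        C * ((d : ℝ) * Real.log d + d / ε) ≤ c →
        0.8 ≤ (selectionLaw U c).real {ω | ∀ β' : EuclideanSpace ℝ (Fin d),
          IsLeastSquaresSolution (samplingMatrix U c ω * X)
              ((samplingMatrix U c ω).toEuclideanLin y) β' →
            ‖y - X.toEuclideanLin β'‖ ^ 2 ≤ (1 + ε) * ‖y - X.toEuclideanLin β‖ ^ 2 ∧
            (0 < sigmaMin X →
              ‖β - β'‖ ^ 2 ≤ ε / sigmaMin X ^ 2 * ‖y - X.toEuclideanLin β‖ ^ 2 ∧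
              ∀ γ : ℝ, 0 < γ → γ * ‖y‖ ≤ ‖(U * U.transpose).toEuclideanLin y‖ →
                ε / sigmaMin X ^ 2 * ‖y - X.toEuclideanLin β‖ ^ 2 ≤
                  ε * condNumber X ^ 2 * ((γ ^ 2)⁻¹ - 1) * ‖β‖ ^ 2)} := by
  refine ⟨200, by norm_num, fun n d X U V y β ε c hd hSVD hβ hε hdε hC => ?_⟩
  have hd' : (0 : ℝ) < d := Nat.cast_pos.2 hd
  have hlog : 0 ≤ Real.log d := Real.log_nonneg (Nat.one_le_cast.2 hd)
  have hK : 200 * (Real.log d + 1 / ε) ≤ (c : ℝ) / d := by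
    rw [le_div_iff₀ hd']
    refine le_trans (le_of_eq ?_) hC
    ring
  have hK0 : 0 < (c : ℝ) / d := lt_of_lt_of_le (by positivity) hK
  have hc' : (0 : ℝ) < c := (div_pos_iff_of_pos_right hd').1 hK0
  have hc : 0 < c := Nat.cast_pos.1 hc'
  obtain ⟨q, hq0, hq, hqd⟩ := exists_exponent hd hε hdε hK
  have hprob : IsProbabilityMeasure (selectionLaw U c) := by unfold selectionLaw; infer_instance
  have hA := measureReal_not_embedding_le hSVD.left_orthonormal hd hc hq0 hq hqd
  have hB := measureReal_sum_sq_le (rangeLeft_sq_le X U)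
    (hSVD.sum_mul_rangeLeft_eq_zero hβ.sum_mul_eq_zero) hd hc
  -- 160 = 16 · 10: the factor from the normal equations times the one from Markov's inequality.
  have hcε : 160 * ((d : ℝ) / c) ≤ ε := by
    have h1 : 160 * (1 / ε) ≤ (c : ℝ) / d := by
      have : 0 < 1 / ε := by positivity
      linarith
    rw [mul_one_div, div_le_div_iff₀ hε hd'] at h1
    rw [← mul_div_assoc, div_le_iff₀ hc']
    linarith
  refine le_trans (b := 1 - (1 / 10 + 1 / 10)) (by norm_num)
    (one_sub_le_measureReal_of_union hA hB ?_)
  intro ω h1 h2 β' hβ'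
  refine hSVD.error_bounds hβ hε ((hSVD.leftCoords_sub_le hβ' (not_not.1 h1)).trans ?_)
  rw [norm_sub_toEuclideanLin_sq]
  have h3 := mul_le_mul_of_nonneg_right hcε
    (Finset.sum_nonneg fun i (_ : i ∈ Finset.univ) =>
      sq_nonneg (y i - (X.mulVec β.ofLp) i))
  linarith [not_not.1 h2]
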